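/- Let $\psi(q)=\sum_{j\ge 0}q^{j(j+1)/2}$ and define the integers $\overline{b}_5(n)$, $n\ge 0$, by $$\sum_{n=0}^{\infty}\overline{b}_5(n)q^n=\frac{\psi^5(-q^5)}{\psi(-q)}=1+q+q^2+2q^3+3q^4-q^5+2q^7-2q^9+6q^{10}+\cdots .$$ Then for every nonnegative integer $n$ and every integer $k\ge 2$, $$4\,\overline{b}_5\left(5^{k}(n+3)-3\right)\equiv 5\,\overline{b}_5(n)-\overline{b}_5(5n+12)\pmod{5^k},$$ $$\overline{b}_5\left(5^k(20n+18)-3\right)\equiv 0\pmod{\tfrac{5^{k}-1}{4}},$$ and $$\overline{b}_5\left(5^k(20n+22)-3\right)\equiv 0\pmod{\tfrac{5^{k}-1}{4}}.$$ -/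

import Mathlib

/-- Ramanujan's theta function `ψ(q) = ∑_{n ≥ 0} q ^ (n (n + 1) / 2)`, as a formal power series in
`q` with integer coefficients. (If `n (n + 1) / 2 = m` then `n ≤ m`, so the finite sum below ranges
over all `n` that contribute to the coefficient of `q ^ m`.) -/
noncomputable def ramanujanPsi : PowerSeries ℤ :=
  PowerSeries.mk fun m => ∑ n ∈ Finset.range (m + 1), if n * (n + 1) / 2 = m then 1 else 0

/-- The series `ψ(-q) = ∑_{n ≥ 0} (-q) ^ (n (n + 1) / 2)`. -/
noncomputable def psiNeg : PowerSeries ℤ :=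
  PowerSeries.rescale (-1) ramanujanPsi

/-- The series `ψ(-q ^ 5)`, obtained from `ψ(-q)` by the substitution `q ↦ q ^ 5`. -/
noncomputable def psiNegFive : PowerSeries ℤ :=
  PowerSeries.expand 5 (by norm_num) psiNeg

theorem constantCoeff_psiNeg : PowerSeries.constantCoeff psiNeg = 1 := by
  rw [← PowerSeries.coeff_zero_eq_constantCoeff_apply]
  simp [psiNeg, ramanujanPsi]
  rfl

/-- The generating series `ψ(-q ^ 5) ^ 5 / ψ(-q)`; the constant coefficient of `ψ(-q)` is `1`, so
`ψ(-q)` is invertible in `ℤ⟦q⟧`. -/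
noncomputable def bBarFiveSeries : PowerSeries ℤ :=
  psiNegFive ^ 5 * PowerSeries.invOfUnit psiNeg 1

/-- `bBarFiveSeries` is indeed the quotient of `ψ(-q ^ 5) ^ 5` by `ψ(-q)`. -/
theorem bBarFiveSeries_mul_psiNeg : bBarFiveSeries * psiNeg = psiNegFive ^ 5 := by
  rw [bBarFiveSeries, mul_assoc, PowerSeries.invOfUnit_mul _ _ (by simp [constantCoeff_psiNeg]),
    mul_one]

/-- The coefficient `b̄₅(n)` of `q ^ n` in `ψ(-q ^ 5) ^ 5 / ψ(-q)`, with `b̄₅(n) = 0` for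
`n < 0`. -/
noncomputable def bBarFive (n : ℤ) : ℤ :=
  if 0 ≤ n then PowerSeries.coeff n.toNat bBarFiveSeries else 0

/-! Let P = qψ(q)³ψ(q⁵), Q = q²ψ(q)ψ(q⁵)³, Z = q³ψ(q⁵)⁵/ψ(q) (`psiCubeForm`, `psiFiveCubeForm`,
`psiQuotientForm`), and write F(m) for the coefficient of q^m in F. Up to sign, b̄₅(m - 3) is Z(m).
Let U send F(m) to F(5m). Then UP = 6P - 5Q, UQ = P and UZ = P - 5Q + 5Z, so U fixes P - 5Q and 4UᵏZ
= (5ᵏ - 1)(P - 5Q) + 4·5ᵏZ. Modulo 5ᵏ the right side is -(P - 5Q) = 5Z - UZ, the first congruence.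
If Z(m) = 0, then Z(5ᵏm) is a multiple of (5ᵏ - 1)/4, so the other two follow from Z(2m) = 0 for odd
m ≡ ±1 (mod 5).

The action on P and Q comes from the 5-dissection ψ(q) = A(q⁵) + qB(q⁵) + q³ψ(q²⁵), with A = f(q²,
q³), B = f(q, q⁴) and AB = ψ(q)² - qψ(q⁵)². It also gives P(m) = 3Q(m) for m ≡ ±2 (mod 5).

For Z, the series H = P - 2Q + Z = qE(q⁵)⁵/E(q) satisfies H(q²) = Q - Z, hence H + H(q²) = D with D
= P - Q and UD = 5D. Repeated halving of the index gives UH = 5H, so U(Q - Z) = 5(Q - Z), which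
determines UZ. A theta identity gives D(2m) = 2D(m). For odd m ≡ ±1 (mod 5) this yields 2D(m) =
P(2m) - Q(2m) = 2Q(2m), and Z(2m) = Q(2m) - H(m) = Q(2m) - D(m) = 0.

The series identities rest on the Jacobi triple product and on regrouping sums over ℤ and ℤ². -/

/-! ### Gaussian binomials and the finite triple product. -/

section FiniteTripleProduct

open Finset

variable {R : Type*} [CommRing R]

/-- The Gaussian binomial coefficient `[j + l, j]` at `Q`. -/
def gaussBinom (Q : R) : ℕ → ℕ → R
  | 0, _ => 1
  | _ + 1, 0 => 1
  | j + 1, l + 1 => Q ^ (j + 1) * gaussBinom Q (j + 1) l + gaussBinom Q j (l + 1)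

theorem gaussBinom_zero_left (Q : R) (l : ℕ) : gaussBinom Q 0 l = 1 := by
  rw [gaussBinom]

theorem gaussBinom_zero_right (Q : R) (j : ℕ) : gaussBinom Q j 0 = 1 := by
  cases j <;> rw [gaussBinom]

theorem gaussBinom_succ_succ (Q : R) (j l : ℕ) :
    gaussBinom Q (j + 1) (l + 1) =
      Q ^ (j + 1) * gaussBinom Q (j + 1) l + gaussBinom Q j (l + 1) := by
  rw [gaussBinom]

theorem gaussBinom_mul_prod (Q : R) (j l : ℕ) :
    gaussBinom Q j l * (∏ k ∈ range j, (1 - Q ^ (k + 1))) * (∏ k ∈ range l, (1 - Q ^ (k + 1))) =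
      ∏ k ∈ range (j + l), (1 - Q ^ (k + 1)) := by
  induction j generalizing l with
  | zero => simp [gaussBinom_zero_left]
  | succ j ihj =>
    induction l with
    | zero => simp [gaussBinom_zero_right]
    | succ l ihl =>
      have h1 := ihj (l + 1)
      rw [show j + (l + 1) = j + 1 + l by ring] at h1
      rw [gaussBinom_succ_succ, show j + 1 + (l + 1) = (j + 1 + l) + 1 by ring,
        prod_range_succ _ (j + 1 + l), prod_range_succ _ l]
      rw [prod_range_succ _ l] at h1
      rw [prod_range_succ _ j] at ihl ⊢
      rw [show j + 1 + l + 1 = (j + 1) + (l + 1) by ring, pow_add Q (j + 1) (l + 1)]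
      linear_combination (Q ^ (j + 1) * (1 - Q ^ (l + 1))) * ihl + (1 - Q ^ (j + 1)) * h1

/-- The homogeneous `q`-binomial theorem. -/
theorem prod_add_mul_pow (Q y x : R) (N : ℕ) :
    ∏ k ∈ range N, (y + x * Q ^ k) =
      ∑ p ∈ antidiagonal N, gaussBinom Q p.1 p.2 * Q ^ (p.1.choose 2) * x ^ p.1 * y ^ p.2 := by
  induction N generalizing x with
  | zero => simp [gaussBinom_zero_left]
  | succ N ih =>
    -- The two halves of the Pascal recurrence, set to 0 on the edge where the recurrence has no
    -- such term.
    let u : ℕ → ℕ → R := fun j l => match l with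
      | 0 => 0
      | l + 1 => Q ^ j * gaussBinom Q j l * Q ^ (j.choose 2) * x ^ j * y ^ (l + 1)
    let v : ℕ → ℕ → R := fun j l => match j with
      | 0 => 0
      | j + 1 => gaussBinom Q j l * Q ^ ((j + 1).choose 2) * x ^ (j + 1) * y ^ l
    have huv : ∀ p ∈ antidiagonal (N + 1),
        gaussBinom Q p.1 p.2 * Q ^ (p.1.choose 2) * x ^ p.1 * y ^ p.2 = u p.1 p.2 + v p.1 p.2 := by
      rintro ⟨j, l⟩ hp
      rw [HasAntidiagonal.mem_antidiagonal] at hp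
      match j, l with
      | 0, 0 => simp at hp
      | 0, l + 1 => simp [u, v, gaussBinom_zero_left]
      | j + 1, 0 => simp [u, v, gaussBinom_zero_right]
      | j + 1, l + 1 => simp only [u, v, gaussBinom_succ_succ]; ring
    rw [sum_congr rfl huv, sum_add_distrib, Nat.sum_antidiagonal_succ', Nat.sum_antidiagonal_succ
      (f := fun p => v p.1 p.2), prod_range_succ']
    have h : ∀ k, y + x * Q ^ (k + 1) = y + (x * Q) * Q ^ k := fun k => by ring
    simp_rw [h, ih]
    simp only [u, v, zero_add]
    rw [← sum_add_distrib, sum_mul]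
    refine sum_congr rfl fun p _ => ?_
    rw [Nat.choose_succ_succ' p.1 1, Nat.choose_one_right]
    ring

/-- The triangular number `n (n + 1) / 2` of an integer `n`. -/
def triangular (n : ℤ) : ℕ := (n * (n + 1) / 2).toNat

theorem two_mul_triangular (n : ℤ) : 2 * (triangular n : ℤ) = n * (n + 1) := by
  have h0 : 0 ≤ n * (n + 1) := by
    rcases le_or_gt 0 n with h | h
    · positivity
    · nlinarith
  rw [triangular, Int.toNat_of_nonneg (by positivity)]
  exact Int.mul_ediv_cancel' (Int.even_mul_succ_self n).two_dvd

theorem two_mul_choose_two (n : ℕ) : 2 * (n.choose 2 : ℤ) = n * (n - 1) := by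
  induction n with
  | zero => simp
  | succ n ih =>
    rw [Nat.choose_succ_succ' n 1, Nat.choose_one_right]
    push_cast
    linear_combination ih

/-- The finite form of the Jacobi triple product. -/
theorem prod_mul_prod_eq_sum_gaussBinom [IsDomain R] {a b : R} (ha : a ≠ 0) (hb : b ≠ 0) (m : ℕ) :
    ∏ k ∈ range m, ((1 + a * (a * b) ^ k) * (1 + b * (a * b) ^ k)) =
      ∑ p ∈ antidiagonal (2 * m), gaussBinom (a * b) p.1 p.2 *
        (a ^ triangular (p.1 - m) * b ^ triangular (p.1 - m - 1)) := by
  rcases m with _ | M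
  · simp [gaussBinom_zero_left, triangular]
  set Q := a * b with hQ
  have hQ0 : Q ≠ 0 := mul_ne_zero ha hb
  -- With y = bQ^M and M = m - 1, the lower half of the factors gives Q^k(1 + bQ^(M-k)). In the
  -- upper half Q^(M+1) = abQ^M, which gives bQ^M(1 + aQ^k).
  have key := prod_add_mul_pow Q (b * Q ^ M) 1 (2 * (M + 1))
  have hc : (b * Q ^ M) ^ (M + 1) * Q ^ ((M + 1).choose 2) ≠ 0 := by positivity
  refine mul_left_cancel₀ hc ?_
  have hl : ∏ k ∈ range (M + 1), (b * Q ^ M + 1 * Q ^ k) =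
      Q ^ ((M + 1).choose 2) * ∏ k ∈ range (M + 1), (1 + b * Q ^ k) := by
    rw [← prod_range_reflect (fun k => 1 + b * Q ^ k), Nat.choose_two_right,
      ← sum_range_id, ← prod_pow_eq_pow_sum, ← prod_mul_distrib]
    refine prod_congr rfl fun k hk => ?_
    have hk' : k ≤ M := Nat.lt_succ_iff.mp (mem_range.mp hk)
    have hM : Q ^ M = Q ^ k * Q ^ (M + 1 - 1 - k) := by rw [← pow_add]; congr 1; omega
    rw [hM]; ring
  have hr : ∏ k ∈ range (M + 1), (b * Q ^ M + 1 * Q ^ (M + 1 + k)) =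
      (b * Q ^ M) ^ (M + 1) * ∏ k ∈ range (M + 1), (1 + a * Q ^ k) := by
    have h : ∀ k, b * Q ^ M + 1 * Q ^ (M + 1 + k) = b * Q ^ M * (1 + a * Q ^ k) := fun k => by
      rw [add_right_comm, pow_add, pow_succ, hQ]; ring
    simp_rw [h]
    rw [prod_mul_distrib, prod_const, card_range]
  rw [two_mul, prod_range_add, hl, hr] at key
  rw [prod_mul_distrib, mul_sum, two_mul]
  refine Eq.trans (by ring) (key.trans (sum_congr rfl ?_))
  rintro ⟨j, l⟩ hp
  rw [HasAntidiagonal.mem_antidiagonal] at hp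
  simp only [one_pow, mul_one] at hp ⊢
  have hj : ((j + l : ℕ) : ℤ) = ((M + 1 + (M + 1) : ℕ) : ℤ) := congrArg _ hp
  push_cast at hj
  have t1 := two_mul_triangular ((j : ℤ) - (M + 1 : ℕ))
  have t2 := two_mul_triangular ((j : ℤ) - (M + 1 : ℕ) - 1)
  have c1 := two_mul_choose_two j
  have c2 := two_mul_choose_two (M + 1)
  generalize triangular ((j : ℤ) - (M + 1 : ℕ)) = T1 at t1 ⊢
  generalize triangular ((j : ℤ) - (M + 1 : ℕ) - 1) = T2 at t2 ⊢
  generalize j.choose 2 = C1 at c1 ⊢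
  generalize (M + 1).choose 2 = C2 at c2 ⊢
  push_cast at t1 t2 c2
  have hl' : (l : ℤ) = 2 * M + 2 - j := by linarith
  have e1 : C1 + M * l = M * (M + 1) + C2 + T1 := by
    zify; rw [hl']; linarith
  have e2 : C1 + M * l + l = M * (M + 1) + (M + 1) + C2 + T2 := by
    zify; rw [hl']; linarith
  calc gaussBinom Q j l * Q ^ C1 * (b * Q ^ M) ^ l
      = gaussBinom Q j l * (a ^ (C1 + M * l) * b ^ (C1 + M * l + l)) := by
        rw [hQ]; ring
    _ = _ := by rw [e2, e1, hQ]; ring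

end FiniteTripleProduct

/-! ### Infinite products and the Jacobi triple product. -/

section InfiniteProducts

open Finset PowerSeries Filter Topology
open scoped PowerSeries.WithPiTopology

theorem tendsto_zero_of_X_pow_dvd {f : ℕ → PowerSeries ℤ} (h : ∀ m, X ^ m ∣ f m) :
    Tendsto f atTop (𝓝 0) := by
  rw [WithPiTopology.tendsto_iff_coeff_tendsto]
  intro d
  refine tendsto_const_nhds.congr' ?_
  filter_upwards [eventually_gt_atTop d] with m hm
  rw [map_zero, (X_pow_dvd_iff.mp (h m)) d hm]

theorem X_pow_dvd_sub_of_tendsto {f : ℕ → PowerSeries ℤ} {F c : PowerSeries ℤ} {d : ℕ}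
    (hF : Tendsto f atTop (𝓝 F)) (h : ∀ᶠ m in atTop, X ^ d ∣ f m - c) : X ^ d ∣ F - c := by
  rw [X_pow_dvd_iff]
  intro e he
  have h1 := (WithPiTopology.tendsto_iff_coeff_tendsto (R := ℤ) _ _ _).mp hF e
  rw [map_sub, sub_eq_zero]
  refine tendsto_nhds_unique h1 (tendsto_const_nhds.congr' ?_)
  filter_upwards [h] with m hm
  have := X_pow_dvd_iff.mp hm e he
  rw [map_sub, sub_eq_zero] at this
  exact this.symm

theorem continuous_expand (n : ℕ) (hn : n ≠ 0) :
    Continuous (expand n hn : PowerSeries ℤ → PowerSeries ℤ) := by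
  rw [continuous_iff_continuousAt]
  intro f
  rw [ContinuousAt, WithPiTopology.tendsto_iff_coeff_tendsto]
  intro d
  simp_rw [coeff_expand]
  split_ifs
  · exact (WithPiTopology.continuous_coeff ℤ _).continuousAt
  · exact tendsto_const_nhds

/-- The infinite product `∏ (1 - s q ^ (N k + r))` over `k ≥ 0`. -/
noncomputable def qPochhammer (s : ℤ) (r N : ℕ) : PowerSeries ℤ :=
  ∏' k : ℕ, (1 - C s * X ^ (N * k + r))

theorem tendsto_qPochhammer (s : ℤ) (r : ℕ) {N : ℕ} (hN : 0 < N) :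
    Tendsto (fun m => ∏ k ∈ range m, (1 - C s * X ^ (N * k + r))) atTop
      (𝓝 (qPochhammer s r N)) := by
  have h : Multipliable fun k : ℕ => (1 + -(C s * X ^ (N * k + r)) : PowerSeries ℤ) := by
    refine WithPiTopology.multipliable_one_add_of_tendsto_order_atTop_nhds_top _ ?_
    refine ENat.tendsto_nhds_top_iff_natCast_lt.mpr fun n =>
      Filter.eventually_atTop.mpr ⟨n + 1, fun m hm => ?_⟩
    have h1 : ((N * m + r : ℕ) : ℕ∞) ≤ (-(C s * X ^ (N * m + r)) : PowerSeries ℤ).order := by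
      rw [order_neg]
      refine le_trans ?_ (le_order_mul _ _)
      rw [order_X_pow]
      exact le_add_self
    refine lt_of_lt_of_le ?_ h1
    have : m ≤ N * m := Nat.le_mul_of_pos_left m hN
    exact_mod_cast (by omega : n < N * m + r)
  simp_rw [← sub_eq_add_neg] at h
  exact h.hasProd.tendsto_prod_nat

theorem X_pow_dvd_qPochhammer_sub (s : ℤ) (r : ℕ) {N : ℕ} (hN : 0 < N) (m : ℕ) :
    X ^ (N * m + r) ∣ qPochhammer s r N - ∏ k ∈ range m, (1 - C s * X ^ (N * k + r)) := by
  refine X_pow_dvd_sub_of_tendsto (tendsto_qPochhammer s r hN) ?_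
  filter_upwards [eventually_ge_atTop m] with n hn
  induction n, hn using Nat.le_induction with
  | base => simp
  | succ n hn ih =>
    rw [prod_range_succ]
    have h : (X : PowerSeries ℤ) ^ (N * m + r) ∣ X ^ (N * n + r) :=
      pow_dvd_pow _ (by gcongr)
    have h2 := dvd_sub ih (h.mul_left ((∏ k ∈ range n, (1 - C s * X ^ (N * k + r))) * C s))
    convert h2 using 1
    ring

theorem constantCoeff_qPochhammer (s : ℤ) {r N : ℕ} (hr : 0 < r) (hN : 0 < N) :
    constantCoeff (qPochhammer s r N) = 1 := by
  have h := X_pow_dvd_qPochhammer_sub s r hN 0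
  have h2 := X_pow_dvd_iff.mp h 0 (by omega)
  simpa [sub_eq_zero] using h2

theorem qPochhammer_ne_zero (s : ℤ) {r N : ℕ} (hr : 0 < r) (hN : 0 < N) :
    qPochhammer s r N ≠ 0 := fun h => by
  simpa [h] using constantCoeff_qPochhammer s hr hN

theorem prod_range_mul (f : ℕ → PowerSeries ℤ) (d m : ℕ) :
    ∏ k ∈ range (d * m), f k = ∏ i ∈ range d, ∏ k ∈ range m, f (d * k + i) := by
  rw [Finset.prod_comm]
  induction m with
  | zero => simp
  | succ m ih => rw [Nat.mul_succ, prod_range_add, prod_range_succ, ih]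

theorem qPochhammer_split (s : ℤ) (r : ℕ) {N d : ℕ} (hN : 0 < N) (hd : 0 < d) :
    qPochhammer s r N = ∏ i ∈ range d, qPochhammer s (N * i + r) (N * d) := by
  have h1 := (tendsto_qPochhammer s r hN).comp (tendsto_id.const_mul_atTop' hd)
  have h2 := tendsto_finsetProd (range d)
    fun i _ => tendsto_qPochhammer s (N * i + r) (Nat.mul_pos hN hd)
  refine tendsto_nhds_unique h1 (h2.congr fun m => ?_)
  simp only [Function.comp_apply, id_eq]
  rw [prod_range_mul]
  refine prod_congr rfl fun i _ => prod_congr rfl fun k _ => ?_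
  congr 3
  ring

theorem qPochhammer_mul_neg (s : ℤ) (r : ℕ) {N : ℕ} (hN : 0 < N) :
    qPochhammer s r N * qPochhammer (-s) r N = qPochhammer (s ^ 2) (2 * r) (2 * N) := by
  have h := (tendsto_qPochhammer s r hN).mul (tendsto_qPochhammer (-s) r hN)
  refine tendsto_nhds_unique h ((tendsto_qPochhammer (s ^ 2) (2 * r)
    (Nat.mul_pos two_pos hN)).congr fun m => ?_)
  rw [← prod_mul_distrib]
  refine prod_congr rfl fun k _ => ?_
  rw [show 2 * N * k + 2 * r = (N * k + r) * 2 by ring, pow_mul, map_neg, map_pow]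
  ring

theorem expand_qPochhammer (s : ℤ) (r : ℕ) {N n : ℕ} (hN : 0 < N) (hn : n ≠ 0) :
    expand n hn (qPochhammer s r N) = qPochhammer s (n * r) (n * N) := by
  have h := ((continuous_expand n hn).tendsto _).comp (tendsto_qPochhammer s r hN)
  refine tendsto_nhds_unique h ((tendsto_qPochhammer s (n * r)
    (Nat.mul_pos (Nat.pos_of_ne_zero hn) hN)).congr fun m => ?_)
  simp only [Function.comp_apply, map_prod, map_sub, map_one, map_mul, map_pow, expand_X,
    expand_C]
  refine prod_congr rfl fun k _ => ?_
  rw [← pow_mul]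
  congr 3
  ring

theorem monomial_eq_C_mul (n : ℕ) (a : ℤ) :
    (monomial n a : PowerSeries ℤ) = C a * X ^ n := by
  ext d
  rw [coeff_monomial, coeff_C_mul, coeff_X_pow, mul_ite, mul_one, mul_zero]

/-- The general term `s ^ n q ^ (i n (n + 1) / 2 + j n (n - 1) / 2)` of Ramanujan's theta function
`f(s q ^ i, s q ^ j)`. -/
noncomputable def thetaTerm (s : ℤ) (i j : ℕ) (n : ℤ) : PowerSeries ℤ :=
  monomial (i * triangular n + j * triangular (n - 1)) (s ^ n.natAbs)

theorem triangular_add_triangular_sub_one (n : ℤ) :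
    triangular n + triangular (n - 1) = n.natAbs ^ 2 := by
  have h1 := two_mul_triangular n
  have h2 := two_mul_triangular (n - 1)
  zify
  rw [sq_abs]
  linarith

theorem natAbs_le_thetaTerm_exponent {i j : ℕ} (hi : 0 < i) (hj : 0 < j) (n : ℤ) :
    n.natAbs ≤ i * triangular n + j * triangular (n - 1) := by
  have h1 := triangular_add_triangular_sub_one n
  have h2 : n.natAbs ≤ n.natAbs ^ 2 := Nat.le_self_pow two_ne_zero _
  have h3 : triangular n ≤ i * triangular n := Nat.le_mul_of_pos_left _ hi
  have h4 : triangular (n - 1) ≤ j * triangular (n - 1) := Nat.le_mul_of_pos_left _ hj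
  omega

/-- A family of monomials whose exponents take each value finitely often is summable. -/
theorem summable_monomial {ι : Type*} (w : ι → ℕ) (c : ι → ℤ)
    (h : ∀ d, {i | w i = d}.Finite) :
    Summable fun i => (monomial (w i) (c i) : PowerSeries ℤ) := by
  rw [WithPiTopology.summable_iff_summable_coeff]
  intro d
  refine summable_of_hasFiniteSupport ((h d).subset fun i hi => ?_)
  by_contra hne
  exact hi ((coeff_monomial _ _ _).trans (if_neg (Ne.symm hne)))

theorem summable_thetaTerm (s : ℤ) {i j : ℕ} (hi : 0 < i) (hj : 0 < j) :
    Summable (thetaTerm s i j) := by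
  refine summable_monomial _ _ fun d => (Set.finite_Icc (-(d : ℤ)) d).subset fun n hn => ?_
  have h1 := natAbs_le_thetaTerm_exponent hi hj n
  have h2 : i * triangular n + j * triangular (n - 1) = d := hn
  rw [Set.mem_Icc]
  omega

theorem thetaTerm_eq {s : ℤ} (hs : s ^ 2 = 1) (i j : ℕ) (n : ℤ) :
    thetaTerm s i j n = (C s * X ^ i) ^ triangular n * (C s * X ^ j) ^ triangular (n - 1) := by
  have h : s ^ n.natAbs = s ^ (triangular n + triangular (n - 1)) := by
    rw [triangular_add_triangular_sub_one]
    rcases sq_eq_one_iff.mp hs with rfl | rfl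
    · simp
    · exact neg_one_pow_congr (by simp [Nat.even_pow])
  rw [thetaTerm, h, monomial_eq_C_mul, mul_pow, mul_pow, ← pow_mul, ← pow_mul, pow_add, pow_add,
    map_mul, map_pow, map_pow]
  ring

/-- The Gaussian binomial tends to 1/E. All three finite products in `gaussBinom_mul_prod` agree
with E modulo the stated power, so gE² ≡ E, and the unit E cancels. -/
theorem X_pow_dvd_gaussBinom_mul_qPochhammer_sub {N : ℕ} (hN : 0 < N) (j l : ℕ) :
    X ^ (N * (min j l + 1)) ∣ 1 - gaussBinom (X ^ N) j l * qPochhammer 1 N N := by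
  set E := qPochhammer 1 N N with hE
  set d := N * (min j l + 1) with hd
  have hu : IsUnit E := by
    rw [isUnit_iff_constantCoeff, constantCoeff_qPochhammer 1 hN hN]
    exact isUnit_one
  have hp : ∀ m, min j l ≤ m →
      X ^ d ∣ E - ∏ k ∈ range m, (1 - (X ^ N) ^ (k + 1) : PowerSeries ℤ) := fun m hm => by
    have h := X_pow_dvd_qPochhammer_sub 1 N hN m
    have h2 : ∏ k ∈ range m, (1 - C (1 : ℤ) * X ^ (N * k + N)) =
        ∏ k ∈ range m, (1 - (X ^ N) ^ (k + 1) : PowerSeries ℤ) :=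
      prod_congr rfl fun k _ => by rw [map_one, one_mul, ← pow_mul, mul_add_one]
    rw [h2, ← mul_add_one] at h
    exact (pow_dvd_pow X (by rw [hd]; gcongr)).trans h
  have h1 := hp j (min_le_left _ _)
  have h2 := hp l (min_le_right _ _)
  have h3 := hp (j + l) ((min_le_left _ _).trans (Nat.le_add_right _ _))
  have hg := gaussBinom_mul_prod (X ^ N : PowerSeries ℤ) j l
  rw [← hu.dvd_mul_left]
  generalize (∏ k ∈ range j, (1 - (X ^ N) ^ (k + 1) : PowerSeries ℤ)) = a at h1 hg
  generalize (∏ k ∈ range l, (1 - (X ^ N) ^ (k + 1) : PowerSeries ℤ)) = b at h2 hg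
  generalize (∏ k ∈ range (j + l), (1 - (X ^ N) ^ (k + 1) : PowerSeries ℤ)) = c at h3 hg
  generalize gaussBinom (X ^ N : PowerSeries ℤ) j l = g at hg ⊢
  have h4 := dvd_sub h3 (dvd_add (h1.mul_left (g * E)) (h2.mul_left (g * a)))
  convert h4 using 1
  linear_combination -hg

/-- The Jacobi triple product identity for `f(s q ^ i, s q ^ j)`. -/
theorem hasSum_thetaTerm {s : ℤ} (hs : s ^ 2 = 1) {i j : ℕ} (hi : 0 < i) (hj : 0 < j) :
    HasSum (thetaTerm s i j)
      (qPochhammer (-s) i (i + j) * qPochhammer (-s) j (i + j) *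
        qPochhammer 1 (i + j) (i + j)) := by
  have hN : 0 < i + j := by omega
  have hs0 : (C s : PowerSeries ℤ) ≠ 0 := by
    rw [Ne, map_eq_zero_iff C C_injective]
    rintro rfl
    simp at hs
  set a : PowerSeries ℤ := C s * X ^ i with ha
  set b : PowerSeries ℤ := C s * X ^ j with hb
  have ha0 : a ≠ 0 := mul_ne_zero hs0 (pow_ne_zero _ X_ne_zero)
  have hb0 : b ≠ 0 := mul_ne_zero hs0 (pow_ne_zero _ X_ne_zero)
  have hab : a * b = X ^ (i + j) := by
    have : (C s : PowerSeries ℤ) ^ 2 = 1 := by rw [← map_pow, hs, map_one]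
    rw [ha, hb, pow_add]
    linear_combination (X ^ i * X ^ j) * this
  set E := qPochhammer 1 (i + j) (i + j) with hE
  have hsum := (summable_thetaTerm s hi hj).hasSum
  have hIcc := Tendsto.comp hsum (tendsto_Icc_neg (R := ℤ))
  have hprod := ((tendsto_qPochhammer (-s) i hN).mul (tendsto_qPochhammer (-s) j hN)).mul_const E
  -- The n-th term of the difference is the theta term times 1 - [2m, m + n]E. The first factor is
  -- divisible by X^|n|, the second by X^(m - |n|), since the smaller lower index is m - |n|.
  have hdiff : Tendsto (fun m : ℕ => ∑ n ∈ Icc (-(m : ℤ)) m, thetaTerm s i j n -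
      (∏ k ∈ range m, (1 - C (-s) * X ^ ((i + j) * k + i))) *
        (∏ k ∈ range m, (1 - C (-s) * X ^ ((i + j) * k + j))) * E) atTop (𝓝 0) := by
    refine tendsto_zero_of_X_pow_dvd fun m => ?_
    have h1 := prod_mul_prod_eq_sum_gaussBinom ha0 hb0 m
    have h2 : (∏ k ∈ range m, (1 - C (-s) * X ^ ((i + j) * k + i))) *
        (∏ k ∈ range m, (1 - C (-s) * X ^ ((i + j) * k + j))) =
        ∏ k ∈ range m, ((1 + a * (a * b) ^ k) * (1 + b * (a * b) ^ k)) := by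
      rw [← prod_mul_distrib]
      refine prod_congr rfl fun k _ => ?_
      rw [hab, ← pow_mul, map_neg, ha, hb, pow_add _ _ i, pow_add _ _ j]
      ring
    have h3 : ∑ n ∈ Icc (-(m : ℤ)) m, thetaTerm s i j n =
        ∑ p ∈ antidiagonal (2 * m), thetaTerm s i j (p.1 - m) := by
      symm
      refine sum_nbij' (fun p => (p.1 : ℤ) - m) (fun n => ((n + m).toNat, (m - n).toNat)) ?_ ?_ ?_
        ?_ ?_
      · rintro ⟨p, q⟩ h
        simp only [HasAntidiagonal.mem_antidiagonal, mem_Icc] at h ⊢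
        omega
      · intro n h
        simp only [HasAntidiagonal.mem_antidiagonal, mem_Icc] at h ⊢
        omega
      · rintro ⟨p, q⟩ h
        simp only [HasAntidiagonal.mem_antidiagonal, Prod.mk.injEq] at h ⊢
        omega
      · intro n h
        simp only [mem_Icc] at h ⊢
        omega
      · simp
    rw [h2, h1, h3, sum_mul, ← sum_sub_distrib]
    refine dvd_sum ?_
    rintro ⟨p, q⟩ hp
    rw [HasAntidiagonal.mem_antidiagonal] at hp
    simp only at hp ⊢
    rw [← thetaTerm_eq hs, hab]
    have hg := X_pow_dvd_gaussBinom_mul_qPochhammer_sub hN p q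
    have ht : X ^ ((p : ℤ) - m).natAbs ∣ thetaTerm s i j (p - m) := by
      refine (pow_dvd_pow X (natAbs_le_thetaTerm_exponent hi hj _)).trans ?_
      rw [thetaTerm, monomial_eq_C_mul]
      exact dvd_mul_left _ _
    have hm : m ≤ ((p : ℤ) - m).natAbs + (i + j) * (min p q + 1) := by
      have : min p q + 1 ≤ (i + j) * (min p q + 1) := Nat.le_mul_of_pos_left _ hN
      omega
    refine (pow_dvd_pow X hm).trans ?_
    rw [pow_add]
    convert mul_dvd_mul ht hg using 1
    ring
  have h := hdiff.add hprod
  simp only [sub_add_cancel, zero_add] at h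
  have hIcc' : Tendsto (fun m : ℕ => ∑ n ∈ Icc (-(m : ℤ)) m, thetaTerm s i j n) atTop
      (𝓝 (∑' n, thetaTerm s i j n)) := hIcc
  rw [tendsto_nhds_unique h hIcc']
  exact hsum

end InfiniteProducts

/-! ### Theta functions as products, and tools for rearranging sums. -/

section ProductIdentities

open Finset PowerSeries

/-- Euler's product `∏ (1 - q ^ (n k))` over `k ≥ 1`. -/
noncomputable def eulerProduct (n : ℕ) : PowerSeries ℤ := qPochhammer 1 n n

theorem expand_eulerProduct {m n : ℕ} (hn : 0 < n) (hm : m ≠ 0) :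
    expand m hm (eulerProduct n) = eulerProduct (m * n) :=
  expand_qPochhammer 1 n hn hm

theorem eulerProduct_ne_zero {n : ℕ} (hn : 0 < n) : eulerProduct n ≠ 0 :=
  qPochhammer_ne_zero 1 hn hn

/-- Ramanujan's theta function `φ(s q)` for `s = ± 1`. -/
noncomputable def ramanujanPhi (s : ℤ) : PowerSeries ℤ :=
  qPochhammer (-s) 1 2 * qPochhammer (-s) 1 2 * qPochhammer 1 2 2

/-- Ramanujan's theta function `f(q ^ 2, q ^ 3)`. -/
noncomputable def thetaTwoThree : PowerSeries ℤ :=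
  qPochhammer (-1) 2 5 * qPochhammer (-1) 3 5 * qPochhammer 1 5 5

/-- Ramanujan's theta function `f(q, q ^ 4)`. -/
noncomputable def thetaOneFour : PowerSeries ℤ :=
  qPochhammer (-1) 1 5 * qPochhammer (-1) 4 5 * qPochhammer 1 5 5

theorem qPochhammer_one_mul_neg_one (r : ℕ) {N : ℕ} (hN : 0 < N) :
    qPochhammer 1 r N * qPochhammer (-1) r N = qPochhammer 1 (2 * r) (2 * N) := by
  simpa using qPochhammer_mul_neg 1 r hN

/-- Splitting E(q) modulo 4 pairs the factors with signs ±1 in the classes 1 and 3. The results, in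
the classes 2 and 6 modulo 8, recombine into the class 2 modulo 4. -/
theorem thetaOneThree_mul_eulerProduct :
    qPochhammer (-1) 1 4 * qPochhammer (-1) 3 4 * qPochhammer 1 4 4 * eulerProduct 1 =
      eulerProduct 2 ^ 2 := by
  have h1 := qPochhammer_split 1 1 Nat.one_pos (show 0 < 4 by norm_num)
  have h2 := qPochhammer_split 1 2 Nat.two_pos Nat.two_pos
  have h3 := qPochhammer_split 1 2 (show 0 < 4 by norm_num) Nat.two_pos
  have h4 := qPochhammer_one_mul_neg_one 1 (show 0 < 4 by norm_num)
  have h5 := qPochhammer_one_mul_neg_one 3 (show 0 < 4 by norm_num)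
  simp only [prod_range_succ, prod_range_zero] at h1 h2 h3
  norm_num at h1 h2 h3 h4 h5
  rw [eulerProduct, eulerProduct, h1, h2]
  linear_combination (qPochhammer 1 3 4 * qPochhammer (-1) 3 4 * qPochhammer 1 4 4 ^ 2 *
    qPochhammer 1 2 4) * h4 + (qPochhammer 1 2 8 * qPochhammer 1 4 4 ^ 2 * qPochhammer 1 2 4) * h5
    - (qPochhammer 1 4 4 ^ 2 * qPochhammer 1 2 4) * h3

theorem thetaTwoThree_mul_thetaOneFour_mul :
    thetaTwoThree * thetaOneFour * (eulerProduct 1 * eulerProduct 10) =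
      eulerProduct 2 * eulerProduct 5 ^ 3 := by
  have h1 := qPochhammer_split (-1) 1 Nat.one_pos (show 0 < 5 by norm_num)
  have h2 := qPochhammer_one_mul_neg_one 1 Nat.one_pos
  have h3 := qPochhammer_one_mul_neg_one 5 (show 0 < 5 by norm_num)
  simp only [prod_range_succ, prod_range_zero] at h1
  norm_num at h1 h2 h3
  simp only [eulerProduct, thetaTwoThree, thetaOneFour]
  rw [← h2, ← h3, h1]
  ring

theorem ramanujanPhi_neg_one_mul_eulerProduct :
    ramanujanPhi (-1) * eulerProduct 2 = eulerProduct 1 ^ 2 := by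
  have h1 := qPochhammer_split 1 1 Nat.one_pos Nat.two_pos
  simp only [prod_range_succ, prod_range_zero] at h1
  norm_num at h1
  rw [ramanujanPhi, eulerProduct, eulerProduct, h1, neg_neg]
  ring

theorem ramanujanPhi_one_mul_neg_one_mul_eulerProduct :
    ramanujanPhi 1 * ramanujanPhi (-1) * eulerProduct 4 ^ 2 = eulerProduct 2 ^ 4 := by
  have h1 := qPochhammer_split 1 2 Nat.two_pos Nat.two_pos
  have h2 := qPochhammer_one_mul_neg_one 1 Nat.two_pos
  simp only [prod_range_succ, prod_range_zero] at h1
  norm_num at h1 h2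
  have h3 : ramanujanPhi 1 * ramanujanPhi (-1) = (qPochhammer 1 2 4 * qPochhammer 1 2 2) ^ 2 := by
    rw [ramanujanPhi, ramanujanPhi, neg_neg, ← h2]
    ring
  rw [h3, eulerProduct, eulerProduct, h1]
  ring

open scoped WithPiTopology

theorem hasSum_ramanujanPhi {s : ℤ} (hs : s ^ 2 = 1) :
    HasSum (thetaTerm s 1 1) (ramanujanPhi s) :=
  hasSum_thetaTerm hs Nat.one_pos Nat.one_pos

theorem hasSum_thetaTwoThree : HasSum (thetaTerm 1 2 3) thetaTwoThree :=
  hasSum_thetaTerm (one_pow 2) (by norm_num) (by norm_num)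

theorem hasSum_thetaOneFour : HasSum (thetaTerm 1 1 4) thetaOneFour :=
  hasSum_thetaTerm (one_pow 2) (by norm_num) (by norm_num)

/-- Euler's pentagonal number theorem. -/
theorem hasSum_eulerProduct_one : HasSum (thetaTerm (-1) 1 2) (eulerProduct 1) := by
  have h1 := qPochhammer_split 1 1 Nat.one_pos (show 0 < 3 by norm_num)
  simp only [prod_range_succ, prod_range_zero] at h1
  norm_num at h1
  rw [eulerProduct, h1]
  exact hasSum_thetaTerm (by norm_num) Nat.one_pos Nat.two_pos

theorem HasSum.expand {ι : Type*} {f : ι → PowerSeries ℤ} {F : PowerSeries ℤ} (h : HasSum f F)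
    (n : ℕ) (hn : n ≠ 0) :
    HasSum (fun i => PowerSeries.expand n hn (f i)) (PowerSeries.expand n hn F) :=
  h.map (PowerSeries.expand n hn) (continuous_expand n hn)

/-- Splitting a convergent sum into finitely many subsums. -/
theorem HasSum.eq_sum_of_bijective {ι κ : Type*} {d : ℕ} {f : ι → PowerSeries ℤ}
    {S : PowerSeries ℤ} (hf : HasSum f S) {e : Fin d → κ → ι} {T : Fin d → PowerSeries ℤ}
    (he : Function.Bijective fun p : Fin d × κ => e p.1 p.2)
    (hT : ∀ c, HasSum (fun k => f (e c k)) (T c)) : S = ∑ c, T c := by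
  have h1 : HasSum (fun p : Fin d × κ => f (e p.1 p.2)) S :=
    (Equiv.ofBijective _ he).hasSum_iff.mpr hf
  exact (h1.prod_fiberwise hT).unique (hasSum_fintype T)

/-- The growth bounds leave finitely many pairs for each exponent, so the double family is summable.
The slack of 1 is needed because the triangular number of -1 is 0. -/
theorem hasSum_mul_monomial {w₁ w₂ : ℤ → ℕ} {c₁ c₂ : ℤ → ℤ} {F G : PowerSeries ℤ}
    (hF : HasSum (fun n => monomial (w₁ n) (c₁ n)) F)
    (hG : HasSum (fun n => monomial (w₂ n) (c₂ n)) G)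
    (h₁ : ∀ n, n.natAbs ≤ w₁ n + 1) (h₂ : ∀ n, n.natAbs ≤ w₂ n + 1) :
    HasSum (fun p : ℤ × ℤ => monomial (w₁ p.1 + w₂ p.2) (c₁ p.1 * c₂ p.2)) (F * G) := by
  have hs := summable_monomial (fun p : ℤ × ℤ => w₁ p.1 + w₂ p.2) (fun p => c₁ p.1 * c₂ p.2)
    fun d => ((Set.finite_Icc (-(d : ℤ) - 1) (d + 1)).prod
      (Set.finite_Icc (-(d : ℤ) - 1) (d + 1))).subset fun p hp => by
        have h3 := h₁ p.1
        have h4 := h₂ p.2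
        have h5 : w₁ p.1 + w₂ p.2 = d := hp
        simp only [Set.mem_prod, Set.mem_Icc]
        omega
  have h := hF.mul hG (by simpa only [monomial_mul_monomial] using hs)
  simpa only [monomial_mul_monomial] using h

theorem natAbs_le_triangular (n : ℤ) : n.natAbs ≤ triangular n + 1 := by
  have h := two_mul_triangular n
  zify
  rcases abs_cases n with ⟨h1, h2⟩ | ⟨h1, h2⟩ <;> nlinarith

/-- Every triangular number is attained twice by `n (n + 1) / 2` with `n` in `ℤ`. -/
theorem hasSum_two_mul_ramanujanPsi :
    HasSum (fun n : ℤ => (monomial (triangular n) 1 : PowerSeries ℤ)) (2 * ramanujanPsi) := by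
  have h : HasSum (fun n : ℕ => (monomial (triangular n) 1 : PowerSeries ℤ)) ramanujanPsi := by
    rw [WithPiTopology.hasSum_iff_hasSum_coeff]
    intro d
    rw [ramanujanPsi, coeff_mk]
    have ht : ∀ n : ℕ, triangular n = n * (n + 1) / 2 := fun n => by
      have h1 := two_mul_triangular n
      have h2 : 2 * triangular n = n * (n + 1) := by exact_mod_cast h1
      omega
    have hc : ∀ n : ℕ, coeff d (monomial (triangular n) 1 : PowerSeries ℤ) =
        if n * (n + 1) / 2 = d then 1 else 0 := fun n => by
      rw [coeff_monomial, ht]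
      simp only [eq_comm]
    simp_rw [hc]
    refine hasSum_sum_of_ne_finset_zero fun n hn => if_neg fun h => hn ?_
    have h1 := two_mul_triangular n
    have h2 : (triangular n : ℤ) = d := by rw [ht, h]
    rw [mem_range]
    zify
    rcases n.eq_zero_or_pos with rfl | hn
    · positivity
    · nlinarith
  rw [two_mul]
  refine HasSum.of_nat_of_neg_add_one h ?_
  have ht : ∀ n : ℕ, triangular (-((n : ℤ) + 1)) = triangular n := fun n => by
    have h1 := two_mul_triangular n
    have h2 := two_mul_triangular (-((n : ℤ) + 1))
    zify
    linarith
  simpa only [ht] using h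

end ProductIdentities

/-! ### Theta identities from partitions of ℤ and ℤ². -/

section Lattices

open Finset PowerSeries
open scoped WithPiTopology

/-- Exponents are compared after doubling, where triangular numbers become polynomials and linear
arithmetic applies. -/
theorem monomial_congr {w w' : ℕ} (h : 2 * (w : ℤ) = 2 * w') (c : ℤ) :
    (monomial w c : PowerSeries ℤ) = monomial w' c := by
  rw [show w = w' by omega]

theorem natCast_mul_left_cancel {n : ℕ} (hn : n ≠ 0) {F G : PowerSeries ℤ}
    (h : (n : PowerSeries ℤ) * F = n * G) : F = G := by
  refine mul_left_cancel₀ (fun h0 => hn ?_) h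
  simpa using congrArg constantCoeff h0

theorem thetaTerm_one (i j : ℕ) :
    thetaTerm 1 i j = fun n => monomial (i * triangular n + j * triangular (n - 1)) 1 := by
  funext n
  rw [thetaTerm, one_pow]

/-- Even and odd n each contribute one copy of f(q, q³) to the doubled series 2ψ. -/
theorem ramanujanPsi_eq_product :
    ramanujanPsi = qPochhammer (-1) 1 4 * qPochhammer (-1) 3 4 * qPochhammer 1 4 4 := by
  have h := hasSum_thetaTerm (one_pow 2) Nat.one_pos (show 0 < 3 by norm_num)
  refine natCast_mul_left_cancel two_ne_zero ?_
  refine (hasSum_two_mul_ramanujanPsi.eq_sum_of_bijective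
    (e := (![fun k => -2 * k, fun k => 2 * k - 1] : Fin 2 → ℤ → ℤ))
    (T := fun _ => qPochhammer (-1) 1 4 * qPochhammer (-1) 3 4 * qPochhammer 1 4 4)
    ?_ ?_).trans (by simp)
  · constructor
    · rintro ⟨c, k⟩ ⟨c', k'⟩ h
      fin_cases c <;> fin_cases c' <;> simp at h ⊢ <;> omega
    · intro n
      rcases Int.even_or_odd' n with ⟨k, rfl | rfl⟩
      · exact ⟨(0, -k), by simp⟩
      · exact ⟨(1, k + 1), by simp; ring⟩
  · intro c
    refine h.congr_fun fun k => ?_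
    rw [thetaTerm_one]
    refine monomial_congr ?_ 1
    have t1 := two_mul_triangular k
    have t2 := two_mul_triangular (k - 1)
    push_cast
    fin_cases c
    · have t3 := two_mul_triangular (-2 * k)
      change 2 * (triangular (-2 * k) : ℤ) = _
      linarith
    · have t3 := two_mul_triangular (2 * k - 1)
      change 2 * (triangular (2 * k - 1) : ℤ) = _
      linarith

theorem ramanujanPsi_mul_eulerProduct : ramanujanPsi * eulerProduct 1 = eulerProduct 2 ^ 2 := by
  rw [ramanujanPsi_eq_product, thetaOneThree_mul_eulerProduct]

theorem hasSum_X_pow_mul_expand_five {w : ℤ → ℕ} {F : PowerSeries ℤ}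
    (h : HasSum (fun n => monomial (w n) 1) F) (d : ℕ) :
    HasSum (fun n => monomial (d + 5 * w n) 1) (X ^ d * expand 5 (by norm_num) F) := by
  refine ((HasSum.expand h 5 (by norm_num)).mul_left (X ^ d)).congr_fun fun n => ?_
  rw [expand_monomial, X_pow_eq, monomial_mul_monomial, one_mul]

theorem expand_five_two (h : 5 ≠ 0) : expand 5 h (2 : PowerSeries ℤ) = 2 :=
  map_ofNat _ 2

/-- The sum for 2ψ over ℤ is split by n mod 5. The reflection n ↦ -1 - n swaps the classes 0, 4
(giving A) and 1, 3 (giving B) and preserves the class 2 (giving 2ψ(q²⁵)). -/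
theorem ramanujanPsi_dissection :
    ramanujanPsi = expand 5 (by norm_num) thetaTwoThree +
      X * expand 5 (by norm_num) thetaOneFour +
      X ^ 3 * expand 5 (by norm_num) (expand 5 (by norm_num) ramanujanPsi) := by
  have hA := hasSum_thetaTwoThree
  have hB := hasSum_thetaOneFour
  have hC := HasSum.expand hasSum_two_mul_ramanujanPsi 5 (by norm_num)
  rw [thetaTerm_one] at hA hB
  simp only [expand_monomial] at hC
  have hA' := hasSum_X_pow_mul_expand_five hA 0
  have hB' := hasSum_X_pow_mul_expand_five hB 1
  have hC' := hasSum_X_pow_mul_expand_five hC 3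
  refine natCast_mul_left_cancel two_ne_zero ?_
  refine (hasSum_two_mul_ramanujanPsi.eq_sum_of_bijective
    (e := (![fun k => -5 * k, fun k => 5 * k - 1, fun k => 5 * k - 2, fun k => 1 - 5 * k,
      fun k => 5 * k + 2] : Fin 5 → ℤ → ℤ))
    (T := ![_, _, _, _, _]) ?_ (Fin.forall_fin_succ.mpr ⟨hA'.congr_fun ?_,
      Fin.forall_fin_succ.mpr ⟨hA'.congr_fun ?_, Fin.forall_fin_succ.mpr ⟨hB'.congr_fun ?_,
      Fin.forall_fin_succ.mpr ⟨hB'.congr_fun ?_, Fin.forall_fin_succ.mpr ⟨hC'.congr_fun ?_,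
      fun c => c.elim0⟩⟩⟩⟩⟩)).trans ?_
  · constructor
    · rintro ⟨c, k⟩ ⟨c', k'⟩ h
      fin_cases c <;> fin_cases c' <;> simp at h ⊢ <;> omega
    · intro n
      rcases (by omega : n % 5 = 0 ∨ n % 5 = 4 ∨ n % 5 = 3 ∨ n % 5 = 1 ∨ n % 5 = 2) with
        h | h | h | h | h
      · exact ⟨(0, -(n / 5)), by simp; omega⟩
      · exact ⟨(1, n / 5 + 1), by simp; omega⟩
      · exact ⟨(2, n / 5 + 1), by simp; omega⟩
      · exact ⟨(3, -(n / 5)), by simp; omega⟩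
      · exact ⟨(4, n / 5), by simp; omega⟩
  · intro k
    refine monomial_congr (w := triangular (-5 * k)) ?_ 1
    push_cast
    linarith [two_mul_triangular k, two_mul_triangular (k - 1), two_mul_triangular (-5 * k)]
  · intro k
    refine monomial_congr (w := triangular (5 * k - 1)) ?_ 1
    push_cast
    linarith [two_mul_triangular k, two_mul_triangular (k - 1), two_mul_triangular (5 * k - 1)]
  · intro k
    refine monomial_congr (w := triangular (5 * k - 2)) ?_ 1
    push_cast
    linarith [two_mul_triangular k, two_mul_triangular (k - 1), two_mul_triangular (5 * k - 2)]
  · intro k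
    refine monomial_congr (w := triangular (1 - 5 * k)) ?_ 1
    push_cast
    linarith [two_mul_triangular k, two_mul_triangular (k - 1), two_mul_triangular (1 - 5 * k)]
  · intro k
    refine monomial_congr (w := triangular (5 * k + 2)) ?_ 1
    push_cast
    linarith [two_mul_triangular k, two_mul_triangular (k - 1), two_mul_triangular (5 * k + 2)]
  · simp [Fin.sum_univ_succ, expand_five_two]
    ring

/-- Twice the sum of the triangular numbers of x and y is, up to scaling and shift, (2x + 1)² + (2y
+ 1)². The lattice splits by x + 2y mod 5, each class being parametrized by a similarity of norm 5.
The class 1 reproduces 4ψ(q⁵)² with a factor q, and each of the other four gives AB. -/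
theorem ramanujanPsi_sq :
    ramanujanPsi ^ 2 = thetaTwoThree * thetaOneFour +
      X * expand 5 (by norm_num) ramanujanPsi ^ 2 := by
  have h0 := hasSum_mul_monomial hasSum_two_mul_ramanujanPsi hasSum_two_mul_ramanujanPsi
    natAbs_le_triangular natAbs_le_triangular
  have hA := hasSum_thetaTwoThree
  have hB := hasSum_thetaOneFour
  rw [thetaTerm_one] at hA hB
  have hAB := hasSum_mul_monomial hA hB
    (fun n => (natAbs_le_thetaTerm_exponent two_pos (show 0 < 3 by norm_num) n).trans
      (Nat.le_succ _))
    (fun n => (natAbs_le_thetaTerm_exponent one_pos (show 0 < 4 by norm_num) n).trans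
      (Nat.le_succ _))
  have hC := (HasSum.expand h0 5 (by norm_num)).mul_left X
  refine natCast_mul_left_cancel four_ne_zero ?_
  have key := h0.eq_sum_of_bijective
    (e := (![fun p => (p.1 + 2 * p.2 + 1, 2 * p.1 - p.2),
      fun p => (p.1 - 2 * p.2, 2 * p.1 + p.2 - 1),
      fun p => (2 * p.1 + p.2 - 1, -p.1 + 2 * p.2 - 1),
      fun p => (-p.1 + 2 * p.2 - 1, -2 * p.1 - p.2),
      fun p => (-2 * p.1 - p.2, p.1 - 2 * p.2)] : Fin 5 → ℤ × ℤ → ℤ × ℤ))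
    (T := ![_, _, _, _, _]) ?_ (Fin.forall_fin_succ.mpr ⟨hC.congr_fun ?_,
      Fin.forall_fin_succ.mpr ⟨hAB.congr_fun ?_, Fin.forall_fin_succ.mpr ⟨hAB.congr_fun ?_,
      Fin.forall_fin_succ.mpr ⟨hAB.congr_fun ?_, Fin.forall_fin_succ.mpr ⟨hAB.congr_fun ?_,
      fun c => c.elim0⟩⟩⟩⟩⟩)
  · simp [Fin.sum_univ_succ, expand_five_two] at key
    push_cast
    linear_combination key
  · constructor
    · rintro ⟨c, k, l⟩ ⟨c', k', l'⟩ h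
      fin_cases c <;> fin_cases c' <;> simp at h ⊢ <;> omega
    · rintro ⟨x, y⟩
      rcases (by omega : (x + 2 * y - 1) % 5 = 0 ∨ (x + 2 * y - 1) % 5 = 2 ∨
        (x + 2 * y - 1) % 5 = 1 ∨ (x + 2 * y - 1) % 5 = 3 ∨ (x + 2 * y - 1) % 5 = 4) with
        h | h | h | h | h
      · exact ⟨(0, (x + 2 * y - 1) / 5, 2 * ((x + 2 * y - 1) / 5) - y), by simp; omega⟩
      · exact ⟨(1, (x + 2 * y + 2) / 5, y + 1 - 2 * ((x + 2 * y + 2) / 5)), by simp; omega⟩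
      · exact ⟨(2, (2 * x - y + 1) / 5, x + 1 - 2 * ((2 * x - y + 1) / 5)), by simp; omega⟩
      · exact ⟨(3, -((x + 2 * y + 1) / 5), 2 * ((x + 2 * y + 1) / 5) - y), by simp; omega⟩
      · exact ⟨(4, (y - 2 * x) / 5, -x - 2 * ((y - 2 * x) / 5)), by simp; omega⟩
  · rintro ⟨m, n⟩
    rw [expand_monomial, X_eq, monomial_mul_monomial, one_mul]
    refine monomial_congr (w := triangular (m + 2 * n + 1) + triangular (2 * m - n)) ?_ 1
    push_cast
    linarith [two_mul_triangular m, two_mul_triangular n, two_mul_triangular (m + 2 * n + 1),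
      two_mul_triangular (2 * m - n)]
  · rintro ⟨m, n⟩
    refine monomial_congr (w := triangular (m - 2 * n) + triangular (2 * m + n - 1)) ?_ 1
    push_cast
    linarith [two_mul_triangular m, two_mul_triangular n, two_mul_triangular (m - 1),
      two_mul_triangular (n - 1), two_mul_triangular (m - 2 * n),
      two_mul_triangular (2 * m + n - 1)]
  · rintro ⟨m, n⟩
    refine monomial_congr (w := triangular (2 * m + n - 1) + triangular (-m + 2 * n - 1)) ?_ 1
    push_cast
    linarith [two_mul_triangular m, two_mul_triangular n, two_mul_triangular (m - 1),
      two_mul_triangular (n - 1), two_mul_triangular (-m + 2 * n - 1),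
      two_mul_triangular (2 * m + n - 1)]
  · rintro ⟨m, n⟩
    refine monomial_congr (w := triangular (-m + 2 * n - 1) + triangular (-2 * m - n)) ?_ 1
    push_cast
    linarith [two_mul_triangular m, two_mul_triangular n, two_mul_triangular (m - 1),
      two_mul_triangular (n - 1), two_mul_triangular (-m + 2 * n - 1),
      two_mul_triangular (-2 * m - n)]
  · rintro ⟨m, n⟩
    refine monomial_congr (w := triangular (-2 * m - n) + triangular (m - 2 * n)) ?_ 1
    push_cast
    linarith [two_mul_triangular m, two_mul_triangular n, two_mul_triangular (m - 1),
      two_mul_triangular (n - 1), two_mul_triangular (m - 2 * n),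
      two_mul_triangular (-2 * m - n)]

theorem neg_one_pow_natAbs (n : ℤ) : (-1 : ℤ) ^ n.natAbs = if n % 2 = 0 then 1 else -1 := by
  split_ifs with h
  · exact Even.neg_one_pow (Int.natAbs_even.mpr (Int.even_iff.mpr h))
  · exact Odd.neg_one_pow (Int.natAbs_odd.mpr (Int.odd_iff.mpr (by omega)))

theorem hasSum_zero_of_involution {ι : Type*} {f : ι → PowerSeries ℤ} (hf : Summable f)
    (e : ι ≃ ι) (he : ∀ i, f (e i) = -f i) : HasSum f 0 := by
  obtain ⟨S, hS⟩ := hf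
  have h1 : HasSum (fun i => -f i) S := (e.hasSum_iff.mpr hS).congr_fun fun i => (he i).symm
  have h2 : S = -S := h1.unique hS.neg
  have h3 : ((2 : ℕ) : PowerSeries ℤ) * S = (2 : ℕ) * 0 := by
    push_cast
    linear_combination h2
  rwa [natCast_mul_left_cancel two_ne_zero h3] at hS

theorem thetaTerm_eq_monomial (s : ℤ) (i j : ℕ) :
    thetaTerm s i j = fun n : ℤ =>
      monomial (i * triangular n + j * triangular (n - 1)) (s ^ n.natAbs) := rfl

/-- The left side sums ((-1)^y - (-1)^x) q^(x² + 5y²), which is split by x + y mod 6. Even classes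
vanish, the classes ±1 each give 2qE(q⁴)E(q²⁰) by the pentagonal number theorem, and the class 3
cancels. -/
theorem ramanujanPhi_mul_sub :
    ramanujanPhi 1 * expand 5 (by norm_num) (ramanujanPhi (-1)) -
      ramanujanPhi (-1) * expand 5 (by norm_num) (ramanujanPhi 1) =
      4 * X * eulerProduct 4 * eulerProduct 20 := by
  have hle : ∀ n : ℤ, n.natAbs ≤ 1 * triangular n + 1 * triangular (n - 1) + 1 := fun n =>
    (natAbs_le_thetaTerm_exponent one_pos one_pos n).trans (Nat.le_succ _)
  have hle5 : ∀ n : ℤ, n.natAbs ≤ 5 * (1 * triangular n + 1 * triangular (n - 1)) + 1 :=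
    fun n => by have := hle n; omega
  have hphi : ∀ s t : ℤ, s ^ 2 = 1 → t ^ 2 = 1 → HasSum (fun p : ℤ × ℤ =>
      (monomial (1 * triangular p.1 + 1 * triangular (p.1 - 1) +
        5 * (1 * triangular p.2 + 1 * triangular (p.2 - 1)))
        (s ^ p.1.natAbs * t ^ p.2.natAbs) : PowerSeries ℤ))
      (ramanujanPhi s * expand 5 (by norm_num) (ramanujanPhi t)) := fun s t hs ht => by
    have h1 := hasSum_ramanujanPhi hs
    have h5 := HasSum.expand (hasSum_ramanujanPhi ht) 5 (by norm_num)
    rw [thetaTerm_eq_monomial] at h1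
    simp only [thetaTerm, expand_monomial] at h5
    have h := hasSum_mul_monomial h1 h5 hle hle5
    exact h
  have h0 := (hphi 1 (-1) (by norm_num) (by norm_num)).sub (hphi (-1) 1 (by norm_num) (by norm_num))
  simp only [one_pow, one_mul, mul_one, ← map_sub, neg_one_pow_natAbs] at h0
  have hE4 := HasSum.expand hasSum_eulerProduct_one 4 (by norm_num)
  have hE20 := HasSum.expand hasSum_eulerProduct_one 20 (by norm_num)
  rw [expand_eulerProduct one_pos] at hE4 hE20
  simp only [thetaTerm, expand_monomial] at hE4 hE20
  have hEE := (hasSum_mul_monomial hE4 hE20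
    (fun n => by have := natAbs_le_thetaTerm_exponent one_pos two_pos n; omega)
    (fun n => by have := natAbs_le_thetaTerm_exponent one_pos two_pos n; omega)).mul_left
    (monomial 1 2)
  simp only [monomial_mul_monomial, neg_one_pow_natAbs] at hEE
  set f : ℤ × ℤ → PowerSeries ℤ := fun p =>
    monomial (triangular p.1 + triangular (p.1 - 1) +
      5 * (triangular p.2 + triangular (p.2 - 1)))
      ((if p.2 % 2 = 0 then 1 else -1) - if p.1 % 2 = 0 then 1 else -1) with hf
  have hexp : ∀ x y : ℤ, 2 * ((triangular x + triangular (x - 1) +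
      5 * (triangular y + triangular (y - 1)) : ℕ) : ℤ) = 2 * (x ^ 2 + 5 * y ^ 2) := fun x y => by
    push_cast
    linarith [two_mul_triangular x, two_mul_triangular (x - 1), two_mul_triangular y,
      two_mul_triangular (y - 1)]
  have hf0 : ∀ x y : ℤ, (x + y) % 2 = 0 → f (x, y) = 0 := fun x y h => by
    simp only [hf]
    rw [show ((if y % 2 = 0 then 1 else -1) - if x % 2 = 0 then 1 else -1 : ℤ) = 0 by
      split_ifs <;> omega, map_zero]
  have hf_eq : ∀ x y x' y' : ℤ, (x + y) % 2 = 1 → (x' + y') % 2 = 1 → (y + y') % 2 = 0 →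
      x ^ 2 + 5 * y ^ 2 = x' ^ 2 + 5 * y' ^ 2 → f (x, y) = f (x', y') :=
    fun x y x' y' h1 h2 h3 h4 => by
      simp only [hf]
      rw [monomial_congr (((hexp x y).trans (by rw [h4])).trans (hexp x' y').symm)]
      congr 1
      split_ifs <;> omega
  have hf_neg : ∀ x y x' y' : ℤ, (x + y) % 2 = 1 → (x' + y') % 2 = 1 → (y + y') % 2 = 1 →
      x ^ 2 + 5 * y ^ 2 = x' ^ 2 + 5 * y' ^ 2 → f (x, y) = -f (x', y') :=
    fun x y x' y' h1 h2 h3 h4 => by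
      simp only [hf]
      rw [monomial_congr (((hexp x y).trans (by rw [h4])).trans (hexp x' y').symm), ← map_neg]
      congr 1
      split_ifs <;> omega
  -- Here x² + 5y² = (6j² - 2j) + (30k² - 10k) + 1: four and twenty times pentagonal numbers, plus
  -- 1.
  have hS0 : HasSum (fun p : ℤ × ℤ => f (p.1 + 5 * p.2 - 1, p.2 - p.1))
      (monomial 1 2 * (eulerProduct 4 * eulerProduct 20)) := by
    refine hEE.congr_fun ?_
    rintro ⟨j, k⟩
    simp only [hf]
    rw [show ((if (k - j) % 2 = 0 then 1 else -1) -
      if (j + 5 * k - 1) % 2 = 0 then 1 else -1 : ℤ) =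
        2 * ((if j % 2 = 0 then 1 else -1) * if k % 2 = 0 then 1 else -1) by
          split_ifs <;> omega]
    refine monomial_congr ((hexp _ _).trans ?_) _
    push_cast
    linarith [two_mul_triangular j, two_mul_triangular (j - 1), two_mul_triangular k,
      two_mul_triangular (k - 1)]
  have hS2 : HasSum (fun p : ℤ × ℤ => f (p.1 + 5 * p.2 + 1, p.2 - p.1))
      (monomial 1 2 * (eulerProduct 4 * eulerProduct 20)) := by
    refine ((Equiv.neg (ℤ × ℤ)).hasSum_iff.mpr hS0).congr_fun ?_
    rintro ⟨j, k⟩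
    exact hf_eq _ _ _ _ (by omega) (by simp; omega) (by simp) (by simp; ring)
  -- The form equals 6j(j + 1) + 30k(k + 1) + 9, so j ↦ -1 - j preserves it while flipping the
  -- parity of y = k - j, hence the sign.
  have hS4 : HasSum (fun p : ℤ × ℤ => f (p.1 + 5 * p.2 + 3, p.2 - p.1)) 0 := by
    have hinj : Function.Injective fun p : ℤ × ℤ => (p.1 + 5 * p.2 + 3, p.2 - p.1) := by
      rintro ⟨j, k⟩ ⟨j', k'⟩ h
      simp only [Prod.mk.injEq] at h ⊢
      omega
    refine hasSum_zero_of_involution (h0.summable.comp_injective hinj)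
      ((Equiv.subLeft (-1 : ℤ)).prodCongr (Equiv.refl ℤ)) ?_
    rintro ⟨j, k⟩
    exact hf_neg _ _ _ _ (by simp; omega) (by omega) (by simp; omega) (by simp; ring)
  have hSeven : ∀ c : ℤ, c % 2 = 0 →
      HasSum (fun p : ℤ × ℤ => f (p.1 + 5 * p.2 + c, p.2 - p.1)) 0 := fun c hc => by
    refine hasSum_zero.congr_fun ?_
    rintro ⟨j, k⟩
    exact hf0 _ _ (by omega)
  clear_value f
  have key := h0.eq_sum_of_bijective
    (e := fun (c : Fin 6) (p : ℤ × ℤ) => (p.1 + 5 * p.2 + ((c : ℕ) - 1 : ℤ), p.2 - p.1))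
    (T := fun c => if c = 0 ∨ c = 2 then monomial 1 2 * (eulerProduct 4 * eulerProduct 20) else 0)
    ?_ ?_
  · simp [Fin.sum_univ_succ] at key
    rw [key, monomial_eq_C_mul, show (C (2 : ℤ) : PowerSeries ℤ) = 2 from map_ofNat C 2]
    ring
  · constructor
    · rintro ⟨c, j, k⟩ ⟨c', j', k'⟩ h
      simp only [Prod.mk.injEq, Fin.ext_iff] at h ⊢
      omega
    · rintro ⟨x, y⟩
      refine ⟨(⟨((x + y + 1) % 6).toNat, by omega⟩, (x + y + 1) / 6 - y, (x + y + 1) / 6), ?_⟩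
      simp only [Prod.mk.injEq]
      omega
  · intro c
    fin_cases c
    · simpa [← sub_eq_add_neg] using hS0
    · simpa using hSeven 0 (by norm_num)
    · simpa using hS2
    · simpa using hSeven 2 (by norm_num)
    · simpa using hS4
    · simpa using hSeven 4 (by norm_num)

end Lattices

/-! ### The substitution q ↦ -q. -/

section Rescale

open Finset PowerSeries
open scoped WithPiTopology

theorem continuous_rescale_neg_one :
    Continuous (rescale (-1) : PowerSeries ℤ → PowerSeries ℤ) := by
  rw [continuous_iff_continuousAt]
  intro f
  rw [ContinuousAt, WithPiTopology.tendsto_iff_coeff_tendsto]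
  intro d
  simp_rw [coeff_rescale]
  exact ((WithPiTopology.continuous_coeff ℤ d).const_mul _).continuousAt

theorem rescale_neg_one_qPochhammer (s : ℤ) (r : ℕ) {N : ℕ} (hN : 0 < N) (hN2 : Even N) :
    rescale (-1) (qPochhammer s r N) = qPochhammer ((-1) ^ r * s) r N := by
  have h := (continuous_rescale_neg_one.tendsto _).comp (tendsto_qPochhammer s r hN)
  refine tendsto_nhds_unique h ((tendsto_qPochhammer ((-1) ^ r * s) r hN).congr fun m => ?_)
  rw [Function.comp_apply, map_prod]
  refine prod_congr rfl fun k _ => ?_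
  ext d
  simp only [coeff_rescale, map_sub, coeff_one, coeff_C_mul, coeff_X_pow]
  have h2 : (-1 : ℤ) ^ (N * k + r) = (-1) ^ r := by
    rw [pow_add, (hN2.mul_right k).neg_one_pow, one_mul]
  split_ifs with h3 h4 h4
  · rw [← h2, ← h4, h3]; simp
  · simp [h3]
  · rw [h4, h2]; ring
  · simp

theorem rescale_neg_one_ramanujanPhi (s : ℤ) :
    rescale (-1) (ramanujanPhi s) = ramanujanPhi (-s) := by
  simp [ramanujanPhi, rescale_neg_one_qPochhammer _ _ Nat.two_pos even_two]

theorem rescale_neg_one_expand_of_odd {m : ℕ} (hm : m ≠ 0) (ho : Odd m) (f : PowerSeries ℤ) :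
    rescale (-1) (expand m hm f) = expand m hm (rescale (-1) f) := by
  ext d
  rw [coeff_rescale, coeff_expand, coeff_expand]
  split_ifs with h
  · obtain ⟨e, rfl⟩ := h
    rw [Nat.mul_div_cancel_left e (Nat.pos_of_ne_zero hm), coeff_rescale, pow_mul, ho.neg_one_pow]
  · rw [mul_zero]

theorem rescale_neg_one_expand_of_even {m : ℕ} (hm : m ≠ 0) (he : Even m) (f : PowerSeries ℤ) :
    rescale (-1) (expand m hm f) = expand m hm f := by
  ext d
  rw [coeff_rescale, coeff_expand]
  split_ifs with h
  · obtain ⟨e, rfl⟩ := h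
    rw [(he.mul_right e).neg_one_pow, one_mul]
  · rw [mul_zero]

theorem rescale_neg_one_rescale_neg_one (f : PowerSeries ℤ) :
    rescale (-1) (rescale (-1) f) = f := by
  rw [rescale_rescale]
  simp

end Rescale

/-! ### The weight two forms and their behaviour under q ↦ q². -/

section EtaQuotients

open Finset PowerSeries

/-- The series `ψ(q ^ 5)`. -/
noncomputable def psiFive : PowerSeries ℤ := expand 5 (by norm_num) ramanujanPsi

/-- The series `ψ(q ^ 5) ^ 5 / ψ(q)`. -/
noncomputable def psiQuotient : PowerSeries ℤ := rescale (-1) bBarFiveSeries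

theorem psiQuotient_mul_ramanujanPsi : psiQuotient * ramanujanPsi = psiFive ^ 5 := by
  have h := congrArg (rescale (-1)) bBarFiveSeries_mul_psiNeg
  rwa [map_mul, map_pow, psiNeg, psiNegFive, psiNeg, rescale_neg_one_rescale_neg_one,
    rescale_neg_one_expand_of_odd _ (by decide), rescale_neg_one_rescale_neg_one] at h

/-- The weight two series `q ψ(q) ^ 3 ψ(q ^ 5)`. -/
noncomputable def psiCubeForm : PowerSeries ℤ := X * ramanujanPsi ^ 3 * psiFive

/-- The weight two series `q ^ 2 ψ(q) ψ(q ^ 5) ^ 3`. -/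
noncomputable def psiFiveCubeForm : PowerSeries ℤ := X ^ 2 * ramanujanPsi * psiFive ^ 3

/-- The weight two series `q ^ 3 ψ(q ^ 5) ^ 5 / ψ(q)`. -/
noncomputable def psiQuotientForm : PowerSeries ℤ := X ^ 3 * psiQuotient

/-- The weight two series `q E(q ^ 5) ^ 5 / E(q)`, where `E` is Euler's product; see
`eulerForm_mul_eulerProduct`. -/
noncomputable def eulerForm : PowerSeries ℤ :=
  psiCubeForm - 2 * psiFiveCubeForm + psiQuotientForm

theorem ramanujanPsi_ne_zero : ramanujanPsi ≠ 0 := fun h => by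
  have h2 := ramanujanPsi_mul_eulerProduct
  rw [h, zero_mul] at h2
  exact pow_ne_zero 2 (eulerProduct_ne_zero Nat.two_pos) h2.symm

theorem psiFive_mul_eulerProduct : psiFive * eulerProduct 5 = eulerProduct 10 ^ 2 := by
  have h := congrArg (expand 5 (by norm_num)) ramanujanPsi_mul_eulerProduct
  rwa [map_mul, map_pow, expand_eulerProduct Nat.one_pos, expand_eulerProduct Nat.two_pos] at h

theorem psi_sq_sub_mul_eulerProduct :
    (ramanujanPsi ^ 2 - X * psiFive ^ 2) * (eulerProduct 1 * eulerProduct 10) =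
      eulerProduct 2 * eulerProduct 5 ^ 3 := by
  rw [← thetaTwoThree_mul_thetaOneFour_mul, ramanujanPsi_sq, psiFive]
  ring

theorem eulerForm_mul_eulerProduct : eulerForm * eulerProduct 1 = X * eulerProduct 5 ^ 5 := by
  have h1 := psiQuotient_mul_ramanujanPsi
  have h2 := ramanujanPsi_mul_eulerProduct
  have h3 := psiFive_mul_eulerProduct
  have h4 := psi_sq_sub_mul_eulerProduct
  -- The coefficients 1, -2, 1 of `eulerForm` complete the square, so a product formula for ψ² -
  -- qψ(q⁵)² suffices.
  have hH : eulerForm * ramanujanPsi = X * psiFive * (ramanujanPsi ^ 2 - X * psiFive ^ 2) ^ 2 := by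
    rw [eulerForm, psiCubeForm, psiFiveCubeForm, psiQuotientForm]
    linear_combination X ^ 3 * h1
  have hc : ramanujanPsi * (eulerProduct 5 * eulerProduct 1 * eulerProduct 10 ^ 2) ≠ 0 :=
    mul_ne_zero ramanujanPsi_ne_zero (mul_ne_zero (mul_ne_zero
      (eulerProduct_ne_zero (by norm_num)) (eulerProduct_ne_zero (by norm_num)))
      (pow_ne_zero 2 (eulerProduct_ne_zero (by norm_num))))
  refine mul_right_cancel₀ hc ?_
  calc eulerForm * eulerProduct 1 *
        (ramanujanPsi * (eulerProduct 5 * eulerProduct 1 * eulerProduct 10 ^ 2))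
      = (eulerForm * ramanujanPsi) * eulerProduct 1 ^ 2 * eulerProduct 5 * eulerProduct 10 ^ 2 := by
        ring
    _ = X * (psiFive * eulerProduct 5) * ((ramanujanPsi ^ 2 - X * psiFive ^ 2) *
          (eulerProduct 1 * eulerProduct 10)) ^ 2 := by rw [hH]; ring
    _ = X * eulerProduct 5 ^ 6 * eulerProduct 10 ^ 2 * eulerProduct 2 ^ 2 := by
        rw [h3, h4]; ring
    _ = _ := by rw [← h2]; ring

/-- Times ψ, the right side contains ψ² - qψ(q⁵)² to the first power, so it too is a product of
Euler products. -/
theorem expand_two_eulerForm :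
    expand 2 (by norm_num) eulerForm = psiFiveCubeForm - psiQuotientForm := by
  have h1 := psiQuotient_mul_ramanujanPsi
  have h2 := ramanujanPsi_mul_eulerProduct
  have h3 := psiFive_mul_eulerProduct
  have h4 := psi_sq_sub_mul_eulerProduct
  have hV := congrArg (expand 2 (by norm_num)) eulerForm_mul_eulerProduct
  rw [map_mul, map_mul, map_pow, expand_X, expand_eulerProduct Nat.one_pos,
    expand_eulerProduct (by norm_num)] at hV
  norm_num at hV
  have hYZ : (psiFiveCubeForm - psiQuotientForm) * ramanujanPsi =
      X ^ 2 * psiFive ^ 3 * (ramanujanPsi ^ 2 - X * psiFive ^ 2) := by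
    rw [psiFiveCubeForm, psiQuotientForm]
    linear_combination -X ^ 3 * h1
  have hc : ramanujanPsi * (eulerProduct 5 ^ 3 * eulerProduct 1 * eulerProduct 10) ≠ 0 :=
    mul_ne_zero ramanujanPsi_ne_zero (mul_ne_zero (mul_ne_zero
      (pow_ne_zero 3 (eulerProduct_ne_zero (by norm_num))) (eulerProduct_ne_zero (by norm_num)))
      (eulerProduct_ne_zero (by norm_num)))
  refine mul_right_cancel₀ (eulerProduct_ne_zero Nat.two_pos) (hV.trans ?_)
  refine mul_right_cancel₀ hc (Eq.symm ?_)
  calc (psiFiveCubeForm - psiQuotientForm) * eulerProduct 2 *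
        (ramanujanPsi * (eulerProduct 5 ^ 3 * eulerProduct 1 * eulerProduct 10))
      = ((psiFiveCubeForm - psiQuotientForm) * ramanujanPsi) * eulerProduct 2 *
          eulerProduct 5 ^ 3 * eulerProduct 1 * eulerProduct 10 := by ring
    _ = X ^ 2 * (psiFive * eulerProduct 5) ^ 3 * ((ramanujanPsi ^ 2 - X * psiFive ^ 2) *
          (eulerProduct 1 * eulerProduct 10)) * eulerProduct 2 := by rw [hYZ]; ring
    _ = X ^ 2 * eulerProduct 10 ^ 6 * eulerProduct 2 ^ 2 * eulerProduct 5 ^ 3 := by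
        rw [h3, h4]; ring
    _ = _ := by rw [← h2]; ring

/-- The series `q ψ(q) ψ(q ^ 5) (ψ(q) ^ 2 - q ψ(q ^ 5) ^ 2)`. -/
noncomputable def psiDiffForm : PowerSeries ℤ := psiCubeForm - psiFiveCubeForm

theorem psiDiffForm_mul_eulerProduct_one_sq :
    psiDiffForm * eulerProduct 1 ^ 2 =
      X * eulerProduct 2 ^ 3 * eulerProduct 5 ^ 2 * eulerProduct 10 := by
  have h2 := ramanujanPsi_mul_eulerProduct
  have h3 := psiFive_mul_eulerProduct
  have h4 := psi_sq_sub_mul_eulerProduct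
  have hc : eulerProduct 5 * eulerProduct 10 ≠ 0 :=
    mul_ne_zero (eulerProduct_ne_zero (by norm_num)) (eulerProduct_ne_zero (by norm_num))
  refine mul_right_cancel₀ hc ?_
  calc psiDiffForm * eulerProduct 1 ^ 2 * (eulerProduct 5 * eulerProduct 10)
      = X * (ramanujanPsi * eulerProduct 1) * (psiFive * eulerProduct 5) *
        ((ramanujanPsi ^ 2 - X * psiFive ^ 2) * (eulerProduct 1 * eulerProduct 10)) := by
        rw [psiDiffForm, psiCubeForm, psiFiveCubeForm]; ring
    _ = _ := by rw [h2, h3, h4]; ring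

/-- In this form everything but q and the two φ factors is even in q, so q ↦ -q merely changes the
sign and swaps the arguments of φ. -/
theorem psiDiffForm_mul_eulerProduct_two_sq :
    psiDiffForm * eulerProduct 2 ^ 2 =
      X * (ramanujanPhi 1 * expand 5 (by norm_num) (ramanujanPhi (-1))) *
        (eulerProduct 10 ^ 2 * eulerProduct 4 ^ 2) := by
  have h1 := ramanujanPhi_neg_one_mul_eulerProduct
  have h2 := congrArg (expand 5 (by norm_num)) h1
  rw [map_mul, map_pow, expand_eulerProduct Nat.one_pos, expand_eulerProduct Nat.two_pos] at h2
  norm_num at h2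
  have h3 := ramanujanPhi_one_mul_neg_one_mul_eulerProduct
  refine mul_right_cancel₀ (pow_ne_zero 2 (eulerProduct_ne_zero Nat.one_pos)) ?_
  calc psiDiffForm * eulerProduct 2 ^ 2 * eulerProduct 1 ^ 2
      = X * eulerProduct 2 * eulerProduct 5 ^ 2 * eulerProduct 10 * eulerProduct 2 ^ 4 := by
        linear_combination eulerProduct 2 ^ 2 * psiDiffForm_mul_eulerProduct_one_sq
    _ = _ := by rw [← h2, ← h3, ← h1]; ring

/-- Adding the previous formula to its image under q ↦ -q leaves the difference in
`ramanujanPhi_mul_sub`, which turns the sum into an Euler product matching D(q²). -/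
theorem psiDiffForm_add_rescale :
    psiDiffForm + rescale (-1) psiDiffForm = 4 * expand 2 (by norm_num) psiDiffForm := by
  have h1 := psiDiffForm_mul_eulerProduct_two_sq
  have h2 := congrArg (rescale (-1)) h1
  have hE : ∀ n : ℕ, 0 < n → rescale (-1) (eulerProduct (2 * n)) = eulerProduct (2 * n) :=
    fun n hn => by
      rw [← expand_eulerProduct hn two_ne_zero, rescale_neg_one_expand_of_even _ even_two]
  have hX : rescale (-1) (X : PowerSeries ℤ) = -X := by simp
  simp only [map_mul, map_pow, rescale_neg_one_ramanujanPhi, neg_neg, hX,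
    rescale_neg_one_expand_of_odd _ (by decide : Odd 5)] at h2
  rw [hE 1 (by norm_num), hE 2 (by norm_num), hE 5 (by norm_num)] at h2
  norm_num only at h2
  have h3 := congrArg (expand 2 (by norm_num)) psiDiffForm_mul_eulerProduct_one_sq
  simp only [map_mul, map_pow, expand_X] at h3
  rw [expand_eulerProduct Nat.one_pos, expand_eulerProduct Nat.two_pos,
    expand_eulerProduct (by norm_num), expand_eulerProduct (by norm_num)] at h3
  norm_num only at h3
  refine mul_right_cancel₀ (pow_ne_zero 2 (eulerProduct_ne_zero Nat.two_pos)) ?_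
  linear_combination h1 + h2 + X * (eulerProduct 10 ^ 2 * eulerProduct 4 ^ 2) *
    ramanujanPhi_mul_sub - 4 * h3

theorem coeff_two_mul_psiDiffForm (m : ℕ) :
    coeff (2 * m) psiDiffForm = 2 * coeff m psiDiffForm := by
  have h := congrArg (coeff (2 * m)) psiDiffForm_add_rescale
  rw [map_add, coeff_rescale, pow_mul, neg_one_sq, one_pow, one_mul,
    show (4 : PowerSeries ℤ) = C 4 from (map_ofNat C 4).symm, coeff_C_mul, coeff_expand_mul] at h
  linarith

end EtaQuotients

/-! ### Dissections modulo 5. -/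

section Dissections

open Finset PowerSeries

theorem coeff_five_dissection {f : PowerSeries ℤ} (g : Fin 5 → PowerSeries ℤ)
    (h : f = ∑ i : Fin 5, X ^ (i : ℕ) * expand 5 (by norm_num) (g i)) (m : ℕ) (r : Fin 5) :
    coeff (5 * m + r) f = coeff m (g r) := by
  rw [h, map_sum, sum_eq_single r]
  · rw [coeff_X_pow_mul, coeff_expand_mul]
  · intro i _ hi
    have hi' : (i : ℕ) ≠ r := fun h => hi (Fin.ext h)
    rw [coeff_X_pow_mul']
    split_ifs with h
    · exact coeff_expand_of_not_dvd _ _ _ (by omega)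
    · rfl
  · simp

theorem expand_five_ramanujanPsi (h : 5 ≠ 0) : expand 5 h ramanujanPsi = psiFive := rfl

theorem ramanujanPsi_eq_add :
    ramanujanPsi = expand 5 (by norm_num) thetaTwoThree +
      X * expand 5 (by norm_num) thetaOneFour + X ^ 3 * expand 5 (by norm_num) psiFive :=
  ramanujanPsi_dissection

/-- The dissection of ψ is cubed and the terms are sorted by exponent mod 5. The common factor ψ is
the remaining ψ(q⁵) of the form with q⁵ replaced by q. -/
theorem psiCubeForm_dissection :
    psiCubeForm = ∑ i : Fin 5, X ^ (i : ℕ) * expand 5 (by norm_num)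
      ((![ramanujanPsi * (6 * X * thetaTwoThree * thetaOneFour * psiFive + X ^ 2 * psiFive ^ 3),
        ramanujanPsi * (thetaTwoThree ^ 3 + 3 * X * thetaOneFour ^ 2 * psiFive),
        3 * ramanujanPsi * thetaTwoThree * (thetaTwoThree * thetaOneFour + X * psiFive ^ 2),
        3 * ramanujanPsi * thetaOneFour * (thetaTwoThree * thetaOneFour + X * psiFive ^ 2),
        ramanujanPsi * (thetaOneFour ^ 3 + 3 * thetaTwoThree ^ 2 * psiFive)] :
        Fin 5 → PowerSeries ℤ) i) := by
  have h3 : ∀ h : 5 ≠ 0, expand 5 h (3 : PowerSeries ℤ) = 3 := fun h => map_ofNat _ 3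
  have h6 : ∀ h : 5 ≠ 0, expand 5 h (6 : PowerSeries ℤ) = 6 := fun h => map_ofNat _ 6
  have hpsi := ramanujanPsi_eq_add
  rw [psiCubeForm, Fin.sum_univ_five]
  simp only [Matrix.cons_val, Fin.coe_ofNat_eq_mod, map_mul, map_add, map_pow, expand_X, h3, h6,
    expand_five_ramanujanPsi]
  norm_num only
  set S := expand 5 (by norm_num) thetaTwoThree + X * expand 5 (by norm_num) thetaOneFour +
    X ^ 3 * expand 5 (by norm_num) psiFive with hS
  linear_combination X * psiFive * (ramanujanPsi ^ 2 + ramanujanPsi * S + S ^ 2) * hpsi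

theorem psiFiveCubeForm_dissection :
    psiFiveCubeForm = ∑ i : Fin 5, X ^ (i : ℕ) * expand 5 (by norm_num)
      ((![psiCubeForm, 0, ramanujanPsi ^ 3 * thetaTwoThree, ramanujanPsi ^ 3 * thetaOneFour, 0] :
        Fin 5 → PowerSeries ℤ) i) := by
  rw [psiFiveCubeForm, Fin.sum_univ_five]
  simp only [Matrix.cons_val, Fin.coe_ofNat_eq_mod, map_mul, map_zero, map_pow, expand_X,
    psiCubeForm, expand_five_ramanujanPsi]
  norm_num only
  linear_combination X ^ 2 * psiFive ^ 3 * ramanujanPsi_eq_add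

theorem thetaTwoThree_mul_thetaOneFour_add :
    thetaTwoThree * thetaOneFour + X * psiFive ^ 2 = ramanujanPsi ^ 2 :=
  ramanujanPsi_sq.symm

theorem coeff_ofNat_mul (c : ℕ) (m : ℕ) (f : PowerSeries ℤ) :
    coeff m ((c : PowerSeries ℤ) * f) = c * coeff m f := by
  rw [show (c : PowerSeries ℤ) = C (c : ℤ) by simp, coeff_C_mul]

theorem coeff_five_mul_psiCubeForm (m : ℕ) :
    coeff (5 * m) psiCubeForm = 6 * coeff m psiCubeForm - 5 * coeff m psiFiveCubeForm := by
  have h := coeff_five_dissection _ psiCubeForm_dissection m 0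
  have h2 : ramanujanPsi *
      (6 * X * thetaTwoThree * thetaOneFour * psiFive + X ^ 2 * psiFive ^ 3) =
      ((6 : ℕ) : PowerSeries ℤ) * psiCubeForm - ((5 : ℕ) : PowerSeries ℤ) * psiFiveCubeForm := by
    rw [psiCubeForm, psiFiveCubeForm]
    push_cast
    linear_combination 6 * ramanujanPsi * X * psiFive * thetaTwoThree_mul_thetaOneFour_add
  simp only [Matrix.cons_val] at h
  rw [h2, map_sub, coeff_ofNat_mul, coeff_ofNat_mul] at h
  exact_mod_cast h

theorem coeff_five_mul_psiFiveCubeForm (m : ℕ) :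
    coeff (5 * m) psiFiveCubeForm = coeff m psiCubeForm := by
  simpa using coeff_five_dissection _ psiFiveCubeForm_dissection m 0

theorem coeff_five_mul_add_two_psiCubeForm (m : ℕ) :
    coeff (5 * m + 2) psiCubeForm = 3 * coeff (5 * m + 2) psiFiveCubeForm := by
  have h1 := coeff_five_dissection _ psiCubeForm_dissection m 2
  have h2 := coeff_five_dissection _ psiFiveCubeForm_dissection m 2
  simp only [Matrix.cons_val] at h1 h2
  rw [thetaTwoThree_mul_thetaOneFour_add, show 3 * ramanujanPsi * thetaTwoThree * ramanujanPsi ^ 2 =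
    ((3 : ℕ) : PowerSeries ℤ) * (ramanujanPsi ^ 3 * thetaTwoThree) by push_cast; ring, coeff_ofNat_mul, ← h2] at h1
  exact_mod_cast h1

theorem coeff_five_mul_add_three_psiCubeForm (m : ℕ) :
    coeff (5 * m + 3) psiCubeForm = 3 * coeff (5 * m + 3) psiFiveCubeForm := by
  have h1 := coeff_five_dissection _ psiCubeForm_dissection m 3
  have h2 := coeff_five_dissection _ psiFiveCubeForm_dissection m 3
  simp only [Matrix.cons_val] at h1 h2
  rw [thetaTwoThree_mul_thetaOneFour_add, show 3 * ramanujanPsi * thetaOneFour * ramanujanPsi ^ 2 =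
    ((3 : ℕ) : PowerSeries ℤ) * (ramanujanPsi ^ 3 * thetaOneFour) by push_cast; ring, coeff_ofNat_mul, ← h2] at h1
  exact_mod_cast h1

end Dissections

/-! ### Coefficient recurrences, vanishing and signs. -/

section Coefficients

open Finset PowerSeries

theorem coeff_psiDiffForm (m : ℕ) :
    coeff m psiDiffForm = coeff m psiCubeForm - coeff m psiFiveCubeForm := by
  rw [psiDiffForm, map_sub]

theorem eulerForm_eq :
    eulerForm = psiDiffForm - expand 2 (by norm_num) eulerForm := by
  rw [expand_two_eulerForm, eulerForm, psiDiffForm]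
  ring

theorem coeff_eulerForm_of_odd {m : ℕ} (hm : Odd m) :
    coeff m eulerForm = coeff m psiDiffForm := by
  conv_lhs => rw [eulerForm_eq]
  rw [map_sub, coeff_expand_of_not_dvd _ _ _ hm.not_two_dvd_nat, sub_zero]

theorem coeff_two_mul_eulerForm (m : ℕ) :
    coeff (2 * m) eulerForm = coeff (2 * m) psiDiffForm - coeff m eulerForm := by
  conv_lhs => rw [eulerForm_eq]
  rw [map_sub, coeff_expand_mul]

theorem coeff_five_mul_psiDiffForm (m : ℕ) :
    coeff (5 * m) psiDiffForm = 5 * coeff m psiDiffForm := by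
  rw [coeff_psiDiffForm, coeff_psiDiffForm, coeff_five_mul_psiCubeForm,
    coeff_five_mul_psiFiveCubeForm]
  ring

/-- Since H = D - H(q²), the eigenvalue 5 passes from D to H: directly at odd indices, by induction
from m/2 at even ones. -/
theorem coeff_five_mul_eulerForm (m : ℕ) :
    coeff (5 * m) eulerForm = 5 * coeff m eulerForm := by
  induction m using Nat.strong_induction_on with
  | _ m ih =>
    rcases Nat.even_or_odd' m with ⟨k, rfl | rfl⟩
    · rcases k.eq_zero_or_pos with rfl | hk
      · have h0 : coeff 0 eulerForm = 0 := by
          simp [eulerForm, psiCubeForm, psiFiveCubeForm, psiQuotientForm]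
        simp [h0]
      · rw [show 5 * (2 * k) = 2 * (5 * k) by ring, coeff_two_mul_eulerForm,
          coeff_two_mul_eulerForm, ih k (by omega), show 2 * (5 * k) = 5 * (2 * k) by ring,
          coeff_five_mul_psiDiffForm]
        ring
    · have ho : Odd (2 * k + 1) := odd_two_mul_add_one k
      rw [coeff_eulerForm_of_odd ho, coeff_eulerForm_of_odd (Odd.mul (by decide) ho),
        coeff_five_mul_psiDiffForm]

theorem expand_two_coeff_five_mul (m : ℕ) :
    coeff (5 * m) (expand 2 (by norm_num) eulerForm) =
      5 * coeff m (expand 2 (by norm_num) eulerForm) := by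
  by_cases h : 2 ∣ m
  · obtain ⟨k, rfl⟩ := h
    rw [show 5 * (2 * k) = 2 * (5 * k) by ring, coeff_expand_mul, coeff_expand_mul,
      coeff_five_mul_eulerForm]
  · rw [coeff_expand_of_not_dvd _ _ _ h, coeff_expand_of_not_dvd _ _ _ (by omega), mul_zero]

/-- Q - Z = H(q²) inherits the eigenvalue 5, and the action on Q is known. -/
theorem coeff_five_mul_psiQuotientForm (m : ℕ) :
    coeff (5 * m) psiQuotientForm =
      coeff m psiCubeForm - 5 * coeff m psiFiveCubeForm + 5 * coeff m psiQuotientForm := by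
  have h := expand_two_coeff_five_mul m
  rw [expand_two_eulerForm, map_sub, map_sub, coeff_five_mul_psiFiveCubeForm] at h
  linarith

/-- The combination P - 5Q is fixed by m ↦ 5m, so iterating the recurrence sums the geometric series
1 + 5 + ⋯ + 5^(k-1). -/
theorem four_mul_coeff_five_pow_mul_psiQuotientForm (k m : ℕ) :
    4 * coeff (5 ^ k * m) psiQuotientForm =
      (5 ^ k - 1) * (coeff m psiCubeForm - 5 * coeff m psiFiveCubeForm) +
        5 ^ k * (4 * coeff m psiQuotientForm) := by
  induction k generalizing m with
  | zero => simp
  | succ k ih =>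
    rw [pow_succ, mul_assoc, ih, coeff_five_mul_psiQuotientForm, coeff_five_mul_psiCubeForm,
      coeff_five_mul_psiFiveCubeForm]
    ring

theorem coeff_psiQuotientForm_eq_zero {m : ℕ} (hm : Odd m) (h5 : m % 5 = 1 ∨ m % 5 = 4) :
    coeff (2 * m) psiQuotientForm = 0 := by
  have h1 : coeff (2 * m) psiQuotientForm =
      coeff (2 * m) psiFiveCubeForm - coeff m psiDiffForm := by
    have h := congrArg (coeff (2 * m)) expand_two_eulerForm
    rw [coeff_expand_mul, map_sub, coeff_eulerForm_of_odd hm] at h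
    linarith
  have h2 : coeff (2 * m) psiCubeForm = 3 * coeff (2 * m) psiFiveCubeForm := by
    rcases h5 with h | h
    · rw [show 2 * m = 5 * (2 * m / 5) + 2 by omega]
      exact coeff_five_mul_add_two_psiCubeForm _
    · rw [show 2 * m = 5 * (2 * m / 5) + 3 by omega]
      exact coeff_five_mul_add_three_psiCubeForm _
  have h3 := coeff_two_mul_psiDiffForm m
  have h4 := coeff_psiDiffForm (2 * m)
  linarith

/-- The sign is that of q ↦ -q at exponent m - 3. For m < 3 both sides are 0, by the convention for
negative arguments and the factor q³. -/
theorem bBarFive_natCast_sub_three (m : ℕ) :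
    bBarFive ((m : ℤ) - 3) = (-1) ^ (m + 1) * coeff m psiQuotientForm := by
  rw [bBarFive, psiQuotientForm, coeff_X_pow_mul', psiQuotient, coeff_rescale]
  split_ifs with h1 h2 h2
  · obtain ⟨d, rfl⟩ := Nat.exists_eq_add_of_le h2
    rw [← mul_assoc, ← pow_add, show ((3 + d : ℕ) : ℤ) - 3 = d by push_cast; ring, Int.toNat_natCast,
      Nat.add_sub_cancel_left, Even.neg_one_pow ⟨d + 2, by ring⟩, one_mul]
  · omega
  · omega
  · rw [mul_zero]

theorem bBarFive_five_pow_mul_sub_three (k m : ℕ) :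
    bBarFive (5 ^ k * (m : ℤ) - 3) =
      (-1) ^ (m + 1) * coeff (5 ^ k * m) psiQuotientForm := by
  have h := bBarFive_natCast_sub_three (5 ^ k * m)
  push_cast at h
  -- As 5ᵏ is odd, the sign depends only on the parity of m, not on k.
  rw [h, pow_succ, pow_mul, Odd.neg_one_pow (Odd.pow (by decide)), pow_succ]

theorem bBarFive_five_pow_mul_modEq_zero (k : ℕ) {m : ℕ} (hm : coeff m psiQuotientForm = 0) :
    bBarFive (5 ^ k * (m : ℤ) - 3) ≡ 0 [ZMOD ((5 : ℤ) ^ k - 1) / 4] := by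
  have hdvd : (4 : ℤ) ∣ 5 ^ k - 1 := by
    simpa using sub_dvd_pow_sub_pow (5 : ℤ) 1 k
  obtain ⟨c, hc⟩ := hdvd
  have h := four_mul_coeff_five_pow_mul_psiQuotientForm k m
  rw [hm, hc] at h
  rw [bBarFive_five_pow_mul_sub_three, hc, Int.mul_ediv_cancel_left c (by norm_num),
    Int.modEq_zero_iff_dvd]
  refine Dvd.dvd.mul_left ⟨coeff m psiCubeForm - 5 * coeff m psiFiveCubeForm, ?_⟩ _
  linarith

end Coefficients

/-! ### The three congruences. -/

theorem corollary8 (n k : ℕ) (hk : 2 ≤ k) :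
    4 * bBarFive (5 ^ k * ((n : ℤ) + 3) - 3) ≡
        5 * bBarFive (n : ℤ) - bBarFive (5 * (n : ℤ) + 12) [ZMOD (5 : ℤ) ^ k] ∧
    bBarFive (5 ^ k * (20 * (n : ℤ) + 18) - 3) ≡ 0 [ZMOD ((5 : ℤ) ^ k - 1) / 4] ∧
    bBarFive (5 ^ k * (20 * (n : ℤ) + 22) - 3) ≡ 0 [ZMOD ((5 : ℤ) ^ k - 1) / 4] := by
  refine ⟨?_, ?_, ?_⟩
  · have h0 := bBarFive_five_pow_mul_sub_three 0 (n + 3)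
    have h1 := bBarFive_five_pow_mul_sub_three 1 (n + 3)
    have h2 := bBarFive_five_pow_mul_sub_three k (n + 3)
    have h3 := four_mul_coeff_five_pow_mul_psiQuotientForm k (n + 3)
    have h4 := coeff_five_mul_psiQuotientForm (n + 3)
    push_cast at h0 h1 h2
    rw [one_mul, one_mul, add_sub_cancel_right] at h0
    rw [show 5 * ((n : ℤ) + 3) - 3 = 5 * n + 12 by ring] at h1
    rw [h0, h1, h2, h4]
    -- By `h4` the right side is ±(5Z - UZ) = ∓(P - 5Q) at n + 3. Subtracting the left side via `h3`
    -- leaves 5ᵏ times ∓(P - 5Q + 4Z), the witness.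
    refine Int.modEq_iff_dvd.mpr ⟨-(-1) ^ (n + 3 + 1) *
      (PowerSeries.coeff (n + 3) psiCubeForm - 5 * PowerSeries.coeff (n + 3) psiFiveCubeForm +
        4 * PowerSeries.coeff (n + 3) psiQuotientForm), ?_⟩
    linear_combination -(-1) ^ (n + 3 + 1) * h3
  -- 20n + 18 and, below, 20n + 22 are twice the odd numbers 10n + 9 ≡ 4 and 10n + 11 ≡ 1 (mod 5),
  -- where Z vanishes.
  · have h := bBarFive_five_pow_mul_modEq_zero k (coeff_psiQuotientForm_eq_zero
      (m := 10 * n + 9) ⟨5 * n + 4, by ring⟩ (by omega))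
    push_cast at h
    rwa [show 2 * (10 * (n : ℤ) + 9) = 20 * n + 18 by ring] at h
  · have h := bBarFive_five_pow_mul_modEq_zero k (coeff_psiQuotientForm_eq_zero
      (m := 10 * n + 11) ⟨5 * n + 5, by ring⟩ (by omega))
    push_cast at h
    rwa [show 2 * (10 * (n : ℤ) + 11) = 20 * n + 22 by ring] at h
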